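/- Let $\mathbb T$ be the unit circle with normalized Lebesgue measure, let $H^2(\mathbb T)\subset L^2(\mathbb T)$ be the closed linear span of the functions $z\mapsto z^n$, $n=0,1,2,\dots$, and let $P:L^2(\mathbb T)\to H^2(\mathbb T)$ be the orthogonal projection. For a measurable $\omega:\mathbb T\to\mathbb C$ (defined almost everywhere), the Toeplitz operator $T_\omega$ in $H^2(\mathbb T)$ is given by $T_\omega u=P(\omega u)$ on the domain $\operatorname{dom}T_\omega=\{u\in H^2(\mathbb T):\omega u\in L^2(\mathbb T)\}$. For a nonzero complex polynomial $Q$ write $Q=q\,Q_{in}\,Q_{ex}$ with polynomials $q$, $Q_{in}$, $Q_{ex}$ whose zeros are, with multiplicity, the zeros of $Q$ of modulus $=1$, $<1$ and $>1$, respectively; put $Q_{\overline{in}}=q\,Q_{in}$ and $Q_{\overline{ex}}=q\,Q_{ex}$. Let $\breve Q$ be a nonzero polynomial whose zeros are the numbers $1/\overline b$, where $b\neq0$ is a zero of $Q$, with the same multiplicity as $b$; $\breve Q_{ex}$ denotes $(\breve Q)_{ex}$, so that its zeros are the $1/\overline b$ for the zeros $b$ of $Q$ with $0<|b|<1$. (Constant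 factors are irrelevant below.) By convention the only polynomial of negative degree is $0$, and $\deg 0<0$. **Theorem.** Let $\omega=R/S$ with complex polynomials $R\ne0$ and $S\ne0$ without common zeros ($S$ may have zeros on $\mathbb T$), and let $s$ denote the factor of $S$ with the zeros of modulus $1$, so that $S=s\,S_{in}\,S_{ex}$. Then $T_\omega$ is densely defined and closed, and (a) $\operatorname{dom}T_\omega=s\,H^2(\mathbb T)$ and $\operatorname{ran}T_\omega=P\big(\tfrac{R}{S_{in}S_{ex}}H^2(\mathbb T)\big)$; (b) $\ker T_\omega=\big\{S_{\overline{ex}}\,t/R_{ex}:\ t\text{ a polynomial with }\deg t<\deg S_{in}-\deg R_{\overline{in}}\big\}$; (c) $(\operatorname{ran}T_\omega)^\perp=\big\{\breve S_{ex}\,t/\breve R_{ex}:\ t\text{ a polynomial with }\deg t<\deg R_{in}-\deg S_{in}\big\}$, the orthogonal complement being taken in $H^2(\mathbb T)$; (d) the following are equivalent: (1) $T_\omega$ is a Fredholm operator, i.e. it is densely defined and closed, its kernel and cokernel $H^2(\mathbb T)/\operatorname{ran}T_\omega$ are finite-dimensional, and its range is closed; (2) $\operatorname{ran}T_\omega$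 is closed; (3) $R$ has no zeros on $\mathbb T$, i.e. $\omega$ has no zeros on $\mathbb T$. In (b) and (c), if the bound on $\deg t$ is $\le 0$, the only admissible $t$ is $t=0$. -/

import Mathlib

open MeasureTheory Polynomial
open scoped ComplexConjugate

noncomputable section

namespace ToeplitzRational

/-! ### The torus, `L²` and the Hardy space -/

/-- The torus `𝕋`, in the model `ℝ/ℤ`; the point `x` stands for `z = exp (2πix)`, see `zc`. -/
abbrev Torus : Type := UnitAddCircle

/-- The coordinate `z : 𝕋 → ℂ`, `z = exp (2πix)`. It maps the model `ℝ/ℤ` bijectively onto the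
unit circle of `ℂ`. -/
def zc (x : Torus) : ℂ := (AddCircle.toCircle x : ℂ)

/-- Normalized Lebesgue measure on the torus. -/
abbrev lam : Measure Torus := AddCircle.haarAddCircle

/-- The Hilbert space `L²(𝕋)`. -/
abbrev L2 : Type := Lp ℂ 2 lam

/-- The Hardy space `H²(𝕋)`: the closed subspace of `L²(𝕋)` spanned by the orthonormal system
`z ↦ z ^ n`, `n = 0, 1, 2, …`. -/
def H2 : Submodule ℂ L2 :=
  (Submodule.span ℂ (Set.range fun n : ℕ => (fourierLp 2 (n : ℤ) : L2))).topologicalClosure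

instance : CompleteSpace H2 :=
  (Submodule.isClosed_topologicalClosure _).completeSpace_coe

/-- The monomials used in `H2` are the functions `z ^ n`. -/
theorem fourierLp_ae_eq (n : ℕ) : (fourierLp 2 (n : ℤ) : L2) =ᵐ[lam] fun x => zc x ^ n := by
  refine (coeFn_fourierLp 2 (n : ℤ)).trans (Filter.Eventually.of_forall fun x => ?_)
  simp only [fourier_apply, zc, AddCircle.toCircle_zsmul, zpow_natCast, Circle.coe_pow]

/-- The orthogonal projection `P : L²(𝕋) → H²(𝕋)`. -/
def P : L2 →L[ℂ] H2 := H2.orthogonalProjectionOnto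

/-! ### Multiplication operators and Toeplitz operators -/

/-- The multiplication operator `M(ω)` in `L²(𝕋)` on its maximal domain
`{f ∈ L² | ω f ∈ L²}`. -/
def mulOp (ω : Torus → ℂ) : L2 →ₗ.[ℂ] L2 where
  domain :=
    { carrier := {f | MemLp (fun x => ω x * f x) 2 lam}
      add_mem' := fun {f g} hf hg => by
        refine (MemLp.add hf hg).ae_eq ?_
        filter_upwards [Lp.coeFn_add f g] with x hx
        simp only [hx, Pi.add_apply, mul_add]
      zero_mem' := by
        refine (MemLp.zero (ε := ℂ) (μ := lam) (p := 2)).ae_eq ?_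
        filter_upwards [Lp.coeFn_zero ℂ 2 lam] with x hx
        simp only [hx, Pi.zero_apply, mul_zero]
      smul_mem' := fun c f hf => by
        refine (MemLp.const_smul hf c).ae_eq ?_
        filter_upwards [Lp.coeFn_smul c f] with x hx
        simp [hx, mul_left_comm] }
  toFun :=
    { toFun := fun f => MemLp.toLp (fun x => ω x * f.1 x) f.2
      map_add' := fun f g => by
        ext1
        refine (MemLp.coeFn_toLp _).trans (Filter.EventuallyEq.trans ?_ (Lp.coeFn_add _ _).symm)
        filter_upwards [Lp.coeFn_add f.1 g.1, MemLp.coeFn_toLp f.2, MemLp.coeFn_toLp g.2]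
          with x h1 h2 h3
        simp only [Submodule.coe_add, h1, h2, h3, Pi.add_apply, mul_add]
      map_smul' := fun c f => by
        ext1
        refine (MemLp.coeFn_toLp _).trans (Filter.EventuallyEq.trans ?_ (Lp.coeFn_smul _ _).symm)
        filter_upwards [Lp.coeFn_smul c f.1, MemLp.coeFn_toLp f.2] with x h1 h2
        simp [h1, h2, mul_left_comm] }

/-- The Toeplitz operator `T_ω = P M(ω) P*` in `H²(𝕋)`, where `P*` is the inclusion of `H²(𝕋)`
into `L²(𝕋)`. Its domain is `{u ∈ H² | ω u ∈ L²}`. -/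
def toeplitz (ω : Torus → ℂ) : H2 →ₗ.[ℂ] H2 where
  domain := (mulOp ω).domain.comap H2.subtype
  toFun := P.toLinearMap ∘ₗ (mulOp ω).toFun ∘ₗ
    (H2.subtype.restrict (p := (mulOp ω).domain.comap H2.subtype) (q := (mulOp ω).domain)
      fun _ hu => hu)

/-- The function `R/S` on the torus (its values at the finitely many zeros of `S` are
irrelevant). -/
def ratFun (R S : ℂ[X]) (x : Torus) : ℂ := R.eval (zc x) / S.eval (zc x)

/-! ### Kernel, range, and the Fredholm property of an unbounded operator -/

section Unbounded

variable {E F : Type*} [NormedAddCommGroup E] [NormedSpace ℂ E]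
  [NormedAddCommGroup F] [NormedSpace ℂ F]

/-- The kernel of an unbounded operator, as a subspace of the ambient space. -/
def pker (T : E →ₗ.[ℂ] F) : Submodule ℂ E := (LinearMap.ker T.toFun).map T.domain.subtype

/-- The range of an unbounded operator. -/
def pran (T : E →ₗ.[ℂ] F) : Submodule ℂ F := LinearMap.range T.toFun

/-- A Fredholm operator: densely defined, closed, with finite-dimensional kernel and cokernel,
and with closed range. -/
structure IsFredholm (T : E →ₗ.[ℂ] F) : Prop where
  dense : Dense (T.domain : Set E)
  closed : T.IsClosed
  finite_ker : FiniteDimensional ℂ (pker T)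
  finite_coker : FiniteDimensional ℂ (F ⧸ pran T)
  closed_ran : IsClosed (pran T : Set F)

end Unbounded

/-! ### Factors of a polynomial according to the position of its zeros -/

open Classical in
/-- The monic polynomial whose zeros are the zeros of `Q` that satisfy `p`, with the same
multiplicities. -/
def zeroPart (p : ℂ → Prop) (Q : ℂ[X]) : ℂ[X] := ((Q.roots.filter p).map fun b => X - C b).prod

/-- The factor of `Q` with the zeros of modulus `= 1` (for `S` this is `s`). -/
def circ (Q : ℂ[X]) : ℂ[X] := zeroPart (fun b => ‖b‖ = 1) Q

/-- `Q_in`: the factor of `Q` with the zeros of modulus `< 1`. -/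
def inn (Q : ℂ[X]) : ℂ[X] := zeroPart (fun b => ‖b‖ < 1) Q

/-- `Q_ex`: the factor of `Q` with the zeros of modulus `> 1`. It carries the leading coefficient
of `Q`, so that `Q` is the product of its three factors. -/
def ex (Q : ℂ[X]) : ℂ[X] := C Q.leadingCoeff * zeroPart (fun b => 1 < ‖b‖) Q

open Classical in
/-- `Q̆`: the monic polynomial whose zeros are the `1 / conj b`, with the same multiplicity as `b`,
where `b ≠ 0` is a zero of `Q`. -/
def breve (Q : ℂ[X]) : ℂ[X] :=
  ((Q.roots.filter fun b => b ≠ 0).map fun b => X - C (1 / conj b)).prod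

theorem eq_circ_mul_inn_mul_ex (Q : ℂ[X]) : Q = circ Q * inn Q * ex Q := by
  classical
  have h := C_leadingCoeff_mul_prod_multiset_X_sub_C (p := Q)
    ((IsAlgClosed.splits Q).natDegree_eq_card_roots).symm
  have h1 : Q.roots = Q.roots.filter (fun b => ‖b‖ = 1) +
      (Q.roots.filter (fun b => ‖b‖ < 1) + Q.roots.filter (fun b => 1 < ‖b‖)) := by
    ext b
    simp only [Multiset.count_add, Multiset.count_filter]
    rcases lt_trichotomy ‖b‖ 1 with hb | hb | hb
    · simp [hb, hb.ne, not_lt.2 hb.le]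
    · simp [hb]
    · simp [hb, hb.ne', not_lt.2 hb.le]
  rw [h1, Multiset.map_add, Multiset.map_add, Multiset.prod_add, Multiset.prod_add] at h
  refine h.symm.trans ?_
  simp only [circ, inn, ex, zeroPart]
  ring

/-! ### Subspaces described by functions on the torus -/

/-- `φ H²(𝕋)`, as a set of elements of `L²(𝕋)`. -/
def mulH2 (φ : Torus → ℂ) : Set L2 := {f | ∃ g ∈ H2, f =ᵐ[lam] fun x => φ x * g x}

/-- The set of all `φ t` with `t` a polynomial of degree `< d`, where only the zero polynomial has
degree `< d` if `d ≤ 0`; as a set of elements of `L²(𝕋)`. -/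
def polyMul (φ : Torus → ℂ) (d : ℤ) : Set L2 :=
  {f | ∃ t : ℂ[X], (t = 0 ∨ (t.natDegree : ℤ) < d) ∧ f =ᵐ[lam] fun x => φ x * t.eval (zc x)}

end ToeplitzRational

end

/-! Everything is read off from Fourier coefficients. `Low m` and `High m` are the functions with
spectrum in `[m, ∞)` and in `(-∞, m)`; thus `H2 = Low 0`, its orthogonal complement is `High 0`, and
`Low n ⊓ High m` consists of the `z ^ n t` with `deg t < m - n`. The engine is a division principle:
a factor `z - b` can be cancelled from membership in `Low m` if `1 ≤ ‖b‖`, and from membership in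
`High m` (with a shift by one) if `‖b‖ ≤ 1`; conjugate factors obey the mirrored rules. Zeros on the
circle are allowed, although division by them is unbounded, because only decay of the coefficients
is used.

The graph of the operator is `S w = R u`, `P w = v` with `w` in `L2`. A Bézout identity for `R` and
`S` forces `u = s S_ex k` with `k` in `H2`, and leaves `S_in w = R k`. For the kernel, `w` lies in
`High 0`, so division makes `R_ex k` a polynomial of bounded degree. For the complement of the
range, write `f = conj(S_in) x`; orthogonality becomes `conj(R_in) x ∈ High 0`, and `x` is also
bounded below in spectrum, so a polynomial appears again.

If `R` has no zeros on the circle, the range contains the closed subspace `R_in H2` of finite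
codimension, hence is itself closed of finite codimension. Conversely, let `R = (z - a) R'` with
`‖a‖ = 1`. The complement of the range sees only `R_in = R'_in`, so a closed range would contain all
values obtained with `R'` in place of `R`. This yields `H2 = ℂ + (z - a) H2`, which is impossible,
since `(z - a) H2` is dense, not closed, and misses the constant 1. -/

noncomputable section

namespace ToeplitzRational

/-! ### Fourier coefficients and multiplication by continuous functions -/

/-- The `j`-th Fourier coefficient of an element of `L²(𝕋)`. -/
def coef (f : L2) (j : ℤ) : ℂ := inner ℂ (fourierLp 2 j : L2) f

theorem coef_add (f g : L2) (j : ℤ) : coef (f + g) j = coef f j + coef g j := inner_add_right _ _ _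

theorem coef_sub (f g : L2) (j : ℤ) : coef (f - g) j = coef f j - coef g j := inner_sub_right _ _ _

theorem coef_smul (c : ℂ) (f : L2) (j : ℤ) : coef (c • f) j = c * coef f j := inner_smul_right _ _ _

theorem coef_zero (j : ℤ) : coef 0 j = 0 := inner_zero_right _

theorem coef_fourierLp (i j : ℤ) : coef (fourierLp 2 i) j = if j = i then 1 else 0 :=
  orthonormal_iff_ite.1 orthonormal_fourier j i

theorem coef_eq_repr (f : L2) (j : ℤ) : coef f j = fourierBasis.repr f j := by
  rw [HilbertBasis.repr_apply_apply, coe_fourierBasis, coef]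

theorem coef_ext {f g : L2} (h : ∀ j, coef f j = coef g j) : f = g := by
  apply fourierBasis.repr.injective
  ext j
  rw [← coef_eq_repr, ← coef_eq_repr, h]

theorem continuous_coef (j : ℤ) : Continuous fun f : L2 => coef f j :=
  continuous_const.inner continuous_id

theorem inner_eq_tsum (f g : L2) : inner ℂ f g = ∑' j, conj (coef f j) * coef g j := by
  rw [← fourierBasis.tsum_inner_mul_inner f g]
  simp only [coe_fourierBasis, coef, inner_conj_symm]

/-- Bessel's inequality makes the squared moduli summable. This decay is the only analytic input of
the division lemmas. -/
theorem tendsto_coef (f : L2) : Filter.Tendsto (coef f) Filter.cofinite (nhds 0) := by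
  have h := (orthonormal_fourier (T := 1)).inner_products_summable f
  have h2 := h.tendsto_cofinite_zero
  rw [tendsto_zero_iff_norm_tendsto_zero]
  have h3 := (Real.continuous_sqrt.tendsto 0).comp h2
  simpa only [Function.comp_def, Real.sqrt_sq (norm_nonneg _), Real.sqrt_zero, coef] using h3

/-- Multiplication by a continuous function, as a bounded operator in `L²(𝕋)`. -/
def cmul (φ : C(Torus, ℂ)) : L2 →L[ℂ] L2 :=
  -- The Hölder pairing of `L^∞` with `L²`, applied to the class of `φ` in `L^∞`.
  (ContinuousLinearMap.mul ℂ ℂ).holderL lam ⊤ 2 2 (ContinuousMap.toLp ⊤ lam ℂ φ)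

theorem cmul_ae (φ : C(Torus, ℂ)) (f : L2) : cmul φ f =ᵐ[lam] fun x => φ x * f x := by
  refine ((ContinuousLinearMap.mul ℂ ℂ).coeFn_holder (r := 2) (ContinuousMap.toLp ⊤ lam ℂ φ)
    f).trans ?_
  filter_upwards [ContinuousMap.coeFn_toLp (p := ⊤) (𝕜 := ℂ) lam φ] with x hx
  simp only [hx, ContinuousLinearMap.mul_apply']

theorem cmul_mul (φ ψ : C(Torus, ℂ)) (f : L2) : cmul (φ * ψ) f = cmul φ (cmul ψ f) := by
  ext1
  filter_upwards [cmul_ae (φ * ψ) f, cmul_ae φ (cmul ψ f), cmul_ae ψ f] with x h1 h2 h3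
  rw [h1, h2, h3, ContinuousMap.mul_apply, mul_assoc]

theorem cmul_comm (φ ψ : C(Torus, ℂ)) (f : L2) : cmul φ (cmul ψ f) = cmul ψ (cmul φ f) := by
  rw [← cmul_mul, mul_comm, cmul_mul]

theorem cmul_one (f : L2) : cmul 1 f = f := by
  ext1
  filter_upwards [cmul_ae 1 f] with x h1
  simp [h1]

theorem cmul_add (φ ψ : C(Torus, ℂ)) (f : L2) : cmul (φ + ψ) f = cmul φ f + cmul ψ f := by
  simp [cmul]

theorem cmul_sub (φ ψ : C(Torus, ℂ)) (f : L2) : cmul (φ - ψ) f = cmul φ f - cmul ψ f := by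
  simp [cmul]

theorem cmul_smul (c : ℂ) (φ : C(Torus, ℂ)) (f : L2) : cmul (c • φ) f = c • cmul φ f := by
  simp [cmul]

theorem inner_cmul (φ : C(Torus, ℂ)) (f g : L2) :
    inner ℂ f (cmul φ g) = inner ℂ (cmul (star φ) f) g := by
  rw [L2.inner_def, L2.inner_def]
  refine integral_congr_ae ?_
  filter_upwards [cmul_ae φ g, cmul_ae (star φ) f] with x h1 h2
  rw [h1, h2]
  simp [mul_comm, mul_left_comm]

theorem cmul_fourierLp (i j : ℤ) :
    cmul (fourier i) (fourierLp 2 j : L2) = fourierLp 2 (i + j) := by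
  ext1
  filter_upwards [cmul_ae (fourier i) (fourierLp 2 j : L2), coeFn_fourierLp 2 j,
    coeFn_fourierLp 2 (i + j)] with x h1 h2 h3
  rw [h1, h2, h3, fourier_add]

theorem star_fourier (i : ℤ) : star (fourier i : C(Torus, ℂ)) = fourier (-i) := by
  ext x
  rw [fourier_neg]
  rfl

theorem coef_cmul_fourier (i j : ℤ) (f : L2) : coef (cmul (fourier i) f) j = coef f (j - i) := by
  rw [coef, inner_cmul, star_fourier, cmul_fourierLp, coef, neg_add_eq_sub]

/-- Multiplication by an invertible continuous function is bijective. -/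
theorem exists_cmul_eq {φ : C(Torus, ℂ)} (hφ : ∀ x, φ x ≠ 0) :
    ∃ ψ : C(Torus, ℂ), (∀ f, cmul φ (cmul ψ f) = f) ∧ ∀ f, cmul ψ (cmul φ f) = f := by
  obtain ⟨u, hu⟩ := (ContinuousMap.isUnit_iff_forall_ne_zero φ).2 hφ
  refine ⟨(↑u⁻¹ : C(Torus, ℂ)), fun f => ?_, fun f => ?_⟩
  · rw [← cmul_mul, ← hu, Units.mul_inv, cmul_one]
  · rw [← cmul_mul, ← hu, Units.inv_mul, cmul_one]

/-! ### Polynomials as functions on the torus -/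

/-- A polynomial as a continuous function on the torus. -/
def pc (Q : ℂ[X]) : C(Torus, ℂ) := aeval (fourier 1 : C(Torus, ℂ)) Q

theorem pc_apply (Q : ℂ[X]) (x : Torus) : pc Q x = Q.eval (zc x) := by
  rw [pc, aeval_continuousMap_apply, fourier_one, ← zc]

theorem pc_mul (Q Q' : ℂ[X]) : pc (Q * Q') = pc Q * pc Q' := map_mul _ _ _

theorem norm_zc (x : Torus) : ‖zc x‖ = 1 := Circle.norm_coe _

theorem zc_injective : Function.Injective zc :=
  Subtype.val_injective.comp (AddCircle.injective_toCircle one_ne_zero)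

/-- The torus is connected and nontrivial, so it has no isolated points and Haar measure has no
atoms. Hence the zeros of a polynomial on the torus are negligible. -/
instance : NullSingletonClass lam := by
  have : Nontrivial Circle := ⟨1, -1, fun h => by
    have := congrArg (Subtype.val) h
    norm_num at this⟩
  have : Nontrivial Torus := (AddCircle.homeomorphCircle one_ne_zero).toEquiv.nontrivial
  have : ConnectedSpace Torus := inferInstance
  have : Filter.NeBot (nhdsWithin (0 : Torus) {0}ᶜ) := inferInstance
  infer_instance

theorem ae_eval_ne_zero {Q : ℂ[X]} (hQ : Q ≠ 0) : ∀ᵐ x ∂lam, Q.eval (zc x) ≠ 0 := by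
  have h : {x : Torus | Q.eval (zc x) = 0}.Finite := by
    refine Set.Finite.subset ((Q.roots.toFinset.finite_toSet).preimage zc_injective.injOn) ?_
    intro x hx
    simpa [hQ] using hx
  have := h.measure_zero lam
  simpa [ae_iff] using this

theorem cmul_pc_injective {Q : ℂ[X]} (hQ : Q ≠ 0) : Function.Injective (cmul (pc Q)) := by
  intro f g h
  ext1
  filter_upwards [ae_eval_ne_zero hQ, cmul_ae (pc Q) f, cmul_ae (pc Q) g] with x h0 h1 h2
  rw [h, h2, pc_apply] at h1
  exact (mul_left_cancel₀ h0 h1).symm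

theorem coef_cmul_X_sub_C (b : ℂ) (f : L2) (j : ℤ) :
    coef (cmul (pc (X - C b)) f) j = coef f (j - 1) - b * coef f j := by
  have : pc (X - C b) = fourier 1 - b • 1 := by
    simp [pc, Algebra.algebraMap_eq_smul_one]
  rw [this, cmul_sub, cmul_smul, cmul_one, coef_sub, coef_smul, coef_cmul_fourier]

theorem coef_cmul_star_X_sub_C (b : ℂ) (f : L2) (j : ℤ) :
    coef (cmul (star (pc (X - C b))) f) j = coef f (j + 1) - conj b * coef f j := by
  have : star (pc (X - C b)) = fourier (-1) - conj b • 1 := by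
    rw [← star_fourier]
    ext x
    simp [pc, Algebra.algebraMap_eq_smul_one]
  rw [this, cmul_sub, cmul_smul, cmul_one, coef_sub, coef_smul, coef_cmul_fourier, sub_neg_eq_add]

theorem cmul_pc_C (c : ℂ) (f : L2) : cmul (pc (C c)) f = c • f := by
  have : pc (C c) = c • 1 := by simp [pc, Algebra.algebraMap_eq_smul_one]
  rw [this, cmul_smul, cmul_one]

theorem cmul_star_pc_C (c : ℂ) (f : L2) : cmul (star (pc (C c))) f = conj c • f := by
  have : star (pc (C c)) = conj c • 1 := by
    ext x; simp [pc, Algebra.algebraMap_eq_smul_one]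
  rw [this, cmul_smul, cmul_one]

/-! ### One-sided spectra -/

/-- The functions whose Fourier coefficients vanish below `m`. -/
def Low (m : ℤ) : Submodule ℂ L2 where
  carrier := {f | ∀ j < m, coef f j = 0}
  add_mem' hf hg j hj := by rw [coef_add, hf j hj, hg j hj, add_zero]
  zero_mem' j _ := coef_zero j
  smul_mem' c f hf j hj := by rw [coef_smul, hf j hj, mul_zero]

/-- The functions whose Fourier coefficients vanish from `m` on. -/
def High (m : ℤ) : Submodule ℂ L2 where
  carrier := {f | ∀ j, m ≤ j → coef f j = 0}
  add_mem' hf hg j hj := by rw [coef_add, hf j hj, hg j hj, add_zero]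
  zero_mem' j _ := coef_zero j
  smul_mem' c f hf j hj := by rw [coef_smul, hf j hj, mul_zero]

theorem mem_Low {m : ℤ} {f : L2} : f ∈ Low m ↔ ∀ j < m, coef f j = 0 := Iff.rfl

theorem mem_High {m : ℤ} {f : L2} : f ∈ High m ↔ ∀ j, m ≤ j → coef f j = 0 := Iff.rfl

theorem isClosed_Low (m : ℤ) : IsClosed (Low m : Set L2) := by
  have : (Low m : Set L2) = ⋂ j, ⋂ (_ : j < m), {f | coef f j = 0} := by
    ext f
    simp [mem_Low]
  rw [this]
  exact isClosed_iInter fun j => isClosed_iInter fun _ =>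
    isClosed_singleton.preimage (continuous_coef j)

theorem eq_zero_of_mem_Low_of_mem_High {m n : ℤ} (h : n ≤ m) {f : L2} (hl : f ∈ Low m)
    (hh : f ∈ High n) : f = 0 := by
  refine coef_ext fun j => ?_
  rw [coef_zero]
  rcases lt_or_ge j m with hj | hj
  · exact hl j hj
  · exact hh j (h.trans hj)

/-- Only the coefficients with index in `[m, n)` can be nonzero, and they determine the function. -/
instance finiteDimensional_Low_inf_High (m n : ℤ) :
    FiniteDimensional ℂ (Low m ⊓ High n : Submodule ℂ L2) := by
  let Φ : (Low m ⊓ High n : Submodule ℂ L2) →ₗ[ℂ] (Finset.Ico m n → ℂ) :=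
    { toFun := fun f j => coef f.1 j
      map_add' := fun f g => by ext j; exact coef_add _ _ _
      map_smul' := fun c f => by ext j; exact coef_smul _ _ _ }
  refine FiniteDimensional.of_injective Φ ?_
  rw [← LinearMap.ker_eq_bot, LinearMap.ker_eq_bot']
  intro f hf
  refine Subtype.ext (coef_ext fun j => ?_)
  rw [ZeroMemClass.coe_zero, coef_zero]
  by_cases hj : j ∈ Finset.Ico m n
  · exact congrFun hf ⟨j, hj⟩
  · rw [Finset.mem_Ico, not_and_or, not_le, not_lt] at hj
    exact hj.elim (f.2.1 j) (f.2.2 j)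

theorem eq_zero_of_monotone_of_tendsto {a : ℕ → ℂ} (h : ∀ k, ‖a k‖ ≤ ‖a (k + 1)‖)
    (ht : Filter.Tendsto a Filter.atTop (nhds 0)) (k : ℕ) : a k = 0 := by
  have h1 : Monotone fun k => ‖a k‖ := monotone_nat_of_le_succ h
  have h2 := h1.ge_of_tendsto (by simpa using ht.norm) k
  simpa using h2

theorem tendsto_coef_add (f : L2) (m : ℤ) :
    Filter.Tendsto (fun k : ℕ => coef f (m + k)) Filter.atTop (nhds 0) := by
  refine (tendsto_coef f).comp ?_
  rw [← Nat.cofinite_eq_atTop]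
  exact Function.Injective.tendsto_cofinite fun a b h => by simpa using h

theorem tendsto_coef_sub (f : L2) (m : ℤ) :
    Filter.Tendsto (fun k : ℕ => coef f (m - k)) Filter.atTop (nhds 0) := by
  refine (tendsto_coef f).comp ?_
  rw [← Nat.cofinite_eq_atTop]
  exact Function.Injective.tendsto_cofinite fun a b h => by simpa using h

/-- The moduli do not decrease as the index runs to `-∞`, yet they tend to 0, so they all vanish. -/
theorem mem_Low_of_norm_le {f : L2} {m : ℤ}
    (h : ∀ j < m, ‖coef f j‖ ≤ ‖coef f (j - 1)‖) : f ∈ Low m := by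
  intro j hj
  have := eq_zero_of_monotone_of_tendsto (a := fun k : ℕ => coef f (j - k)) (fun k => ?_)
    (tendsto_coef_sub f j) 0
  · simpa using this
  · refine (h _ (by omega)).trans_eq ?_
    push_cast
    rw [sub_sub]

theorem mem_High_of_norm_le {f : L2} {m : ℤ}
    (h : ∀ j, m ≤ j → ‖coef f j‖ ≤ ‖coef f (j + 1)‖) : f ∈ High m := by
  intro j hj
  have := eq_zero_of_monotone_of_tendsto (a := fun k : ℕ => coef f (j + k)) (fun k => ?_)
    (tendsto_coef_add f j) 0
  · simpa using this
  · refine (h _ (by omega)).trans_eq ?_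
    push_cast
    rw [add_assoc]

/-! ### Multiplication by a polynomial and one-sided spectra -/

/-- Reduces statements about multiplication by `Q` to one linear factor at a time while keeping
track of where the zeros lie. -/
theorem polynomial_induction {p : ℂ → Prop} {Φ : ℂ[X] → Prop} (hC : ∀ c, c ≠ 0 → Φ (C c))
    (hmul : ∀ b Q, p b → Q ≠ 0 → Φ Q → Φ ((X - C b) * Q)) {Q : ℂ[X]} (hQ : Q ≠ 0)
    (hp : ∀ b, Q.IsRoot b → p b) : Φ Q := by
  induction hn : Q.natDegree generalizing Q with
  | zero =>
    rw [eq_C_of_natDegree_eq_zero hn] at hQ ⊢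
    exact hC _ fun h => hQ (by rw [h, C_0])
  | succ n ih =>
    obtain ⟨b, hb⟩ := IsAlgClosed.exists_root Q fun h => by
      rw [natDegree_eq_of_degree_eq_some (n := 0) h] at hn
      omega
    obtain ⟨Q', rfl⟩ := dvd_iff_isRoot.2 hb
    have hQ' : Q' ≠ 0 := right_ne_zero_of_mul hQ
    refine hmul b Q' (hp b hb) hQ' (ih hQ' (fun a ha => hp a (ha.dvd (dvd_mul_left _ _))) ?_)
    rw [natDegree_mul (X_sub_C_ne_zero b) hQ', natDegree_X_sub_C] at hn
    omega

theorem natDegree_X_sub_C_mul (b : ℂ) {Q : ℂ[X]} (hQ : Q ≠ 0) :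
    (((X - C b) * Q).natDegree : ℤ) = 1 + Q.natDegree := by
  rw [natDegree_mul (X_sub_C_ne_zero b) hQ, natDegree_X_sub_C]
  push_cast
  rfl

/-- A factor `z - b` shifts frequencies by 0 or `+1`, its conjugate by 0 or `-1`. So in this and the
next three lemmas only one end of the spectrum moves, by at most the degree. -/
theorem cmul_mem_Low {Q : ℂ[X]} (hQ : Q ≠ 0) {m : ℤ} {f : L2} (hf : f ∈ Low m) :
    cmul (pc Q) f ∈ Low m := by
  refine polynomial_induction (p := fun _ => True) (Φ := fun Q => cmul (pc Q) f ∈ Low m)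
    (fun c _ => ?_) (fun b Q _ _ ih => ?_) hQ fun _ _ => trivial
  · rw [cmul_pc_C]
    exact (Low m).smul_mem c hf
  · intro j hj
    rw [pc_mul, cmul_mul, coef_cmul_X_sub_C, ih j hj, ih _ (by omega)]
    simp

theorem cmul_mem_High {Q : ℂ[X]} (hQ : Q ≠ 0) {m : ℤ} {f : L2} (hf : f ∈ High m) :
    cmul (pc Q) f ∈ High (m + Q.natDegree) := by
  refine polynomial_induction (p := fun _ => True)
    (Φ := fun Q => cmul (pc Q) f ∈ High (m + Q.natDegree))
    (fun c _ => ?_) (fun b Q _ hQ ih => ?_) hQ fun _ _ => trivial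
  · rw [cmul_pc_C]
    simpa using (High m).smul_mem c hf
  · intro j hj
    rw [natDegree_X_sub_C_mul b hQ] at hj
    rw [pc_mul, cmul_mul, coef_cmul_X_sub_C, ih j (by omega), ih _ (by omega)]
    simp

theorem cmul_star_mem_Low {Q : ℂ[X]} (hQ : Q ≠ 0) {m : ℤ} {f : L2} (hf : f ∈ Low m) :
    cmul (star (pc Q)) f ∈ Low (m - Q.natDegree) := by
  refine polynomial_induction (p := fun _ => True)
    (Φ := fun Q => cmul (star (pc Q)) f ∈ Low (m - Q.natDegree))
    (fun c _ => ?_) (fun b Q _ hQ ih => ?_) hQ fun _ _ => trivial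
  · rw [cmul_star_pc_C]
    simpa using (Low m).smul_mem _ hf
  · intro j hj
    rw [natDegree_X_sub_C_mul b hQ] at hj
    rw [pc_mul, star_mul', cmul_mul, coef_cmul_star_X_sub_C, ih j (by omega), ih _ (by omega)]
    simp

theorem cmul_star_mem_High {Q : ℂ[X]} (hQ : Q ≠ 0) {m : ℤ} {f : L2} (hf : f ∈ High m) :
    cmul (star (pc Q)) f ∈ High m := by
  refine polynomial_induction (p := fun _ => True)
    (Φ := fun Q => cmul (star (pc Q)) f ∈ High m)
    (fun c _ => ?_) (fun b Q _ hQ ih => ?_) hQ fun _ _ => trivial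
  · rw [cmul_star_pc_C]
    exact (High m).smul_mem _ hf
  · intro j hj
    rw [pc_mul, star_mul', cmul_mul, coef_cmul_star_X_sub_C, ih j (by omega), ih _ (by omega)]
    simp

/-- Below `m` the coefficients of `(z - b) f` vanish, so those of `f` satisfy `a (j - 1) = b * a j`;
with `1 ≤ ‖b‖` they cannot decay towards `-∞` unless they are 0. The three lemmas that follow use
the same recursion in the other direction or for conjugates. -/
theorem mem_Low_of_cmul {Q : ℂ[X]} (hQ : Q ≠ 0) (hr : ∀ b, Q.IsRoot b → 1 ≤ ‖b‖) {m : ℤ} {f : L2}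
    (hf : cmul (pc Q) f ∈ Low m) : f ∈ Low m := by
  refine polynomial_induction (p := fun b => 1 ≤ ‖b‖)
    (Φ := fun Q => ∀ f, cmul (pc Q) f ∈ Low m → f ∈ Low m)
    (fun c hc f hf => ?_) (fun b Q hb _ ih f hf => ih f (mem_Low_of_norm_le fun j hj => ?_)) hQ hr
    f hf
  · rw [cmul_pc_C] at hf
    exact ((Low m).smul_mem_iff hc).1 hf
  · have := hf j hj
    rw [pc_mul, cmul_mul, coef_cmul_X_sub_C, sub_eq_zero] at this
    rw [this, norm_mul]
    exact le_mul_of_one_le_left (norm_nonneg _) hb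

theorem mem_High_of_cmul {Q : ℂ[X]} (hQ : Q ≠ 0) (hr : ∀ b, Q.IsRoot b → ‖b‖ ≤ 1) {m : ℤ} {f : L2}
    (hf : cmul (pc Q) f ∈ High (m + Q.natDegree)) : f ∈ High m := by
  refine polynomial_induction (p := fun b => ‖b‖ ≤ 1)
    (Φ := fun Q => ∀ f, cmul (pc Q) f ∈ High (m + Q.natDegree) → f ∈ High m)
    (fun c hc f hf => ?_) (fun b Q hb hQ ih f hf => ih f ?_) hQ hr f hf
  · rw [cmul_pc_C] at hf
    simpa using ((High _).smul_mem_iff hc).1 hf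
  · have h : ∀ j, m + Q.natDegree ≤ j → coef (cmul (pc Q) f) j = b * coef (cmul (pc Q) f) (j + 1) :=
      fun j hj => by
        have := hf (j + 1) (by rw [natDegree_X_sub_C_mul b hQ]; omega)
        rwa [pc_mul, cmul_mul, coef_cmul_X_sub_C, sub_eq_zero, add_sub_cancel_right] at this
    refine mem_High_of_norm_le fun j hj => ?_
    rw [h j hj, norm_mul]
    exact mul_le_of_le_one_left (norm_nonneg _) hb

theorem mem_Low_of_cmul_star {Q : ℂ[X]} (hQ : Q ≠ 0) (hr : ∀ b, Q.IsRoot b → ‖b‖ ≤ 1) {m : ℤ}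
    {f : L2} (hf : cmul (star (pc Q)) f ∈ Low (m - Q.natDegree)) : f ∈ Low m := by
  refine polynomial_induction (p := fun b => ‖b‖ ≤ 1)
    (Φ := fun Q => ∀ f, cmul (star (pc Q)) f ∈ Low (m - Q.natDegree) → f ∈ Low m)
    (fun c hc f hf => ?_) (fun b Q hb hQ ih f hf => ih f ?_) hQ hr f hf
  · rw [cmul_star_pc_C] at hf
    simpa using ((Low _).smul_mem_iff (by simpa using hc)).1 hf
  · have h : ∀ j < m - Q.natDegree,
        coef (cmul (star (pc Q)) f) j = conj b * coef (cmul (star (pc Q)) f) (j - 1) :=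
      fun j hj => by
        have := hf (j - 1) (by rw [natDegree_X_sub_C_mul b hQ]; omega)
        rwa [pc_mul, star_mul', cmul_mul, coef_cmul_star_X_sub_C, sub_eq_zero,
          sub_add_cancel] at this
    refine mem_Low_of_norm_le fun j hj => ?_
    rw [h j hj, norm_mul, RCLike.norm_conj]
    exact mul_le_of_le_one_left (norm_nonneg _) hb

theorem mem_High_of_cmul_star {Q : ℂ[X]} (hQ : Q ≠ 0) (hr : ∀ b, Q.IsRoot b → 1 ≤ ‖b‖) {m : ℤ}
    {f : L2} (hf : cmul (star (pc Q)) f ∈ High m) : f ∈ High m := by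
  refine polynomial_induction (p := fun b => 1 ≤ ‖b‖)
    (Φ := fun Q => ∀ f, cmul (star (pc Q)) f ∈ High m → f ∈ High m)
    (fun c hc f hf => ?_) (fun b Q hb _ ih f hf => ih f (mem_High_of_norm_le fun j hj => ?_)) hQ hr
    f hf
  · rw [cmul_star_pc_C] at hf
    exact ((High m).smul_mem_iff (by simpa using hc)).1 hf
  · have := hf j hj
    rw [pc_mul, star_mul', cmul_mul, coef_cmul_star_X_sub_C, sub_eq_zero] at this
    rw [this, norm_mul, RCLike.norm_conj]
    exact le_mul_of_one_le_left (norm_nonneg _) hb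

/-! ### Trigonometric polynomials -/

/-- The function `z ^ n t(z)`, as an element of `L²(𝕋)`. -/
def polyL2 (n : ℤ) (t : ℂ[X]) : L2 := cmul (pc t) (fourierLp 2 n)

theorem polyL2_ae (n : ℤ) (t : ℂ[X]) :
    (polyL2 n t : L2) =ᵐ[lam] fun x => zc x ^ n * t.eval (zc x) := by
  filter_upwards [cmul_ae (pc t) (fourierLp 2 n : L2), coeFn_fourierLp 2 n] with x h1 h2
  rw [polyL2, h1, h2, pc_apply, mul_comm, fourier_apply, AddCircle.toCircle_zsmul, Circle.coe_zpow,
    zc]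

theorem fourierLp_mem_Low (n : ℤ) : (fourierLp 2 n : L2) ∈ Low n := fun j hj => by
  rw [coef_fourierLp, if_neg hj.ne]

theorem fourierLp_mem_High (n : ℤ) : (fourierLp 2 n : L2) ∈ High (n + 1) := fun j hj => by
  rw [coef_fourierLp, if_neg (by omega)]

theorem polyL2_mem_Low (n : ℤ) (t : ℂ[X]) : polyL2 n t ∈ Low n := by
  rcases eq_or_ne t 0 with rfl | ht
  · simp [polyL2, pc, cmul]
  · exact cmul_mem_Low ht (fourierLp_mem_Low n)

theorem polyL2_mem_High {n m : ℤ} {t : ℂ[X]} (ht : t = 0 ∨ (t.natDegree : ℤ) < m - n) :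
    polyL2 n t ∈ High m := by
  rcases eq_or_ne t 0 with rfl | h0
  · simp [polyL2, pc, cmul]
  · have := ht.resolve_left h0
    exact fun j hj => cmul_mem_High h0 (fourierLp_mem_High n) j (by omega)

theorem exists_eq_polyL2 {n m : ℤ} {f : L2} (hl : f ∈ Low n) (hh : f ∈ High m) :
    ∃ t : ℂ[X], (t = 0 ∨ (t.natDegree : ℤ) < m - n) ∧ f = polyL2 n t := by
  refine ⟨∑ i ∈ Finset.range (m - n).toNat, C (coef f (n + i)) * X ^ i, ?_, ?_⟩
  · rcases le_or_gt m n with h | h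
    · left
      rw [Int.toNat_eq_zero.2 (by omega), Finset.sum_range_zero]
    · right
      have : (∑ i ∈ Finset.range (m - n).toNat, C (coef f (n + i)) * X ^ i).natDegree
          ≤ (m - n).toNat - 1 := by
        refine natDegree_sum_le_of_forall_le _ _ fun i hi => ?_
        refine (natDegree_C_mul_X_pow_le _ _).trans ?_
        rw [Finset.mem_range] at hi
        omega
      omega
  · have h1 : ∀ (i : ℕ) (c : ℂ), cmul (pc (C c * X ^ i)) (fourierLp 2 n : L2)
        = c • fourierLp 2 (n + i) := fun i c => by
      have : pc (X ^ i) = fourier i := by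
        ext x
        simp [pc, AddCircle.toCircle_nsmul]
      rw [pc_mul, cmul_mul, cmul_pc_C, this, cmul_fourierLp, add_comm]
    have h2 : ∀ s : Finset ℕ, cmul (pc (∑ i ∈ s, C (coef f (n + i)) * X ^ i)) (fourierLp 2 n : L2)
        = ∑ i ∈ s, coef f (n + i) • (fourierLp 2 (n + i) : L2) := fun s => by
      rw [← Finset.sum_congr rfl fun i _ => h1 i (coef f (n + i))]
      simp only [pc, map_sum, cmul, _root_.sum_apply]
    rw [polyL2, h2]
    refine coef_ext fun j => ?_
    have h3 : coef (∑ i ∈ Finset.range (m - n).toNat,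
        coef f (n + i) • (fourierLp 2 (n + i) : L2)) j
        = ∑ i ∈ Finset.range (m - n).toNat, coef f (n + i) * if j = n + i then 1 else 0 := by
      simp_rw [← coef_fourierLp, ← coef_smul]
      exact inner_sum _ _ _
    rw [h3]
    by_cases hj : n ≤ j ∧ j < m
    · rw [Finset.sum_eq_single (j - n).toNat]
      · rw [Int.toNat_of_nonneg (by omega), add_sub_cancel, if_pos rfl, mul_one]
      · intro i _ hi
        rw [if_neg (by omega), mul_zero]
      · intro h
        rw [Finset.mem_range] at h
        omega
    · rw [Finset.sum_eq_zero]
      · rw [not_and_or, not_le, not_lt] at hj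
        exact hj.elim (hl j) (hh j)
      · intro i hi
        rw [Finset.mem_range] at hi
        rw [if_neg (by omega), mul_zero]

/-! ### The Hardy space in terms of Fourier coefficients -/

theorem orthogonal_H2 : H2ᗮ = High 0 := by
  ext f
  rw [H2, Submodule.orthogonal_closure, Submodule.mem_orthogonal, mem_High]
  constructor
  · intro h j hj
    lift j to ℕ using hj
    exact h _ (Submodule.subset_span ⟨j, rfl⟩)
  · intro h u hu
    induction hu using Submodule.span_induction with
    | mem u hu =>
      obtain ⟨n, rfl⟩ := hu
      exact h n (by omega)
    | zero => exact inner_zero_left _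
    | add u v _ _ hu hv => rw [inner_add_left, hu, hv, add_zero]
    | smul c u _ hu => rw [inner_smul_left, hu, mul_zero]

theorem H2_eq_Low : H2 = Low 0 := by
  apply le_antisymm
  · refine Submodule.topologicalClosure_minimal _ ?_ (isClosed_Low 0)
    rw [Submodule.span_le]
    rintro _ ⟨n, rfl⟩
    exact fun j hj => fourierLp_mem_Low n j (by omega)
  · intro f hf
    -- `H2` is closed, hence equal to its double complement; it remains to see that disjoint spectra
    -- are orthogonal.
    rw [← Submodule.orthogonal_orthogonal H2, orthogonal_H2, Submodule.mem_orthogonal]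
    intro u hu
    rw [inner_eq_tsum, ← tsum_zero]
    refine tsum_congr fun j => ?_
    rcases lt_or_ge j 0 with hj | hj
    · rw [hf j hj, mul_zero]
    · rw [hu j hj, map_zero, zero_mul]

theorem mem_H2 {f : L2} : f ∈ H2 ↔ f ∈ Low 0 := by rw [H2_eq_Low]

theorem P_eq_iff {w : L2} {v : H2} : P w = v ↔ w - v ∈ High 0 := by
  rw [← orthogonal_H2, P, ← Submodule.orthogonalProjectionOnto_eq_zero_iff, map_sub,
    Submodule.orthogonalProjectionOnto_mem_subspace_eq_self, sub_eq_zero]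

theorem inner_P (f : H2) (w : L2) : inner ℂ (P w) f = inner ℂ w (f : L2) :=
  Submodule.inner_orthogonalProjectionOnto_eq_of_mem_right f w

/-! ### The factors of a polynomial -/

theorem zeroPart_ne_zero (p : ℂ → Prop) (Q : ℂ[X]) : zeroPart p Q ≠ 0 :=
  (monic_multisetProd_X_sub_C _).ne_zero

theorem of_isRoot_zeroPart {p : ℂ → Prop} {Q : ℂ[X]} {b : ℂ} (h : (zeroPart p Q).IsRoot b) :
    p b := by
  classical
  rw [← mem_roots (zeroPart_ne_zero p Q), zeroPart, roots_multiset_prod_X_sub_C] at h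
  exact (Multiset.mem_filter.1 h).2

theorem circ_ne_zero (Q : ℂ[X]) : circ Q ≠ 0 := zeroPart_ne_zero _ _

theorem inn_ne_zero (Q : ℂ[X]) : inn Q ≠ 0 := zeroPart_ne_zero _ _

theorem ex_ne_zero {Q : ℂ[X]} (hQ : Q ≠ 0) : ex Q ≠ 0 :=
  mul_ne_zero (C_ne_zero.2 (leadingCoeff_ne_zero.2 hQ)) (zeroPart_ne_zero _ _)

theorem norm_of_isRoot_circ {Q : ℂ[X]} {b : ℂ} (h : (circ Q).IsRoot b) : ‖b‖ = 1 :=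
  of_isRoot_zeroPart h

theorem norm_of_isRoot_inn {Q : ℂ[X]} {b : ℂ} (h : (inn Q).IsRoot b) : ‖b‖ < 1 :=
  of_isRoot_zeroPart h

theorem norm_of_isRoot_ex {Q : ℂ[X]} (hQ : Q ≠ 0) {b : ℂ} (h : (ex Q).IsRoot b) : 1 < ‖b‖ := by
  rw [ex, root_mul, IsRoot.def, eval_C, or_iff_right (leadingCoeff_ne_zero.2 hQ)] at h
  exact of_isRoot_zeroPart h

theorem norm_of_isRoot_circ_mul_ex {Q : ℂ[X]} (hQ : Q ≠ 0) {b : ℂ}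
    (h : (circ Q * ex Q).IsRoot b) : 1 ≤ ‖b‖ := by
  rcases root_mul.1 h with h | h
  · exact (norm_of_isRoot_circ h).ge
  · exact (norm_of_isRoot_ex hQ h).le

theorem norm_of_isRoot_circ_mul_inn {Q : ℂ[X]} {b : ℂ} (h : (circ Q * inn Q).IsRoot b) :
    ‖b‖ ≤ 1 := by
  rcases root_mul.1 h with h | h
  · exact (norm_of_isRoot_circ h).le
  · exact (norm_of_isRoot_inn h).le

theorem norm_ne_of_isRoot_inn_mul_ex {Q : ℂ[X]} (hQ : Q ≠ 0) {b : ℂ}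
    (h : (inn Q * ex Q).IsRoot b) : ‖b‖ ≠ 1 := by
  rcases root_mul.1 h with h | h
  · exact (norm_of_isRoot_inn h).ne
  · exact (norm_of_isRoot_ex hQ h).ne'

theorem circ_eq_one {Q : ℂ[X]} (h : ∀ a : ℂ, ‖a‖ = 1 → Q.eval a ≠ 0) : circ Q = 1 := by
  classical
  rw [circ, zeroPart, Multiset.filter_eq_nil.2, Multiset.map_zero, Multiset.prod_zero]
  exact fun a ha h1 => h a h1 (isRoot_of_mem_roots ha)

theorem inn_mul_of_norm_eq_one {Q : ℂ[X]} {a : ℂ} (hQ : Q ≠ 0) (ha : ‖a‖ = 1) :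
    inn ((X - C a) * Q) = inn Q := by
  classical
  rw [inn, inn, zeroPart, zeroPart, roots_mul (mul_ne_zero (X_sub_C_ne_zero a) hQ),
    roots_X_sub_C, Multiset.filter_add, Multiset.filter_singleton, if_neg ha.not_lt,
    Multiset.empty_eq_zero, zero_add]

/-- On the circle `conj (z - b) * z = 1 - conj b * z = -conj b * (z - 1 / conj b)`, while for `b =
0` the product is 1. So zero roots drop out and the others are reflected. -/
theorem conj_prod_mul_pow (s : Multiset ℂ) [DecidablePred fun b : ℂ => b ≠ 0] :
    ∃ c : ℂ, c ≠ 0 ∧ ∀ z : ℂ, ‖z‖ = 1 →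
      conj ((s.map fun b => X - C b).prod.eval z) * z ^ Multiset.card s
        = c * (((s.filter fun b => b ≠ 0).map fun b => X - C (1 / conj b)).prod).eval z := by
  induction s using Multiset.induction_on with
  | empty => exact ⟨1, one_ne_zero, by simp⟩
  | cons b s ih =>
    obtain ⟨c, hc, h⟩ := ih
    have hz : ∀ z : ℂ, ‖z‖ = 1 → conj z * z = 1 := fun z hz => by
      rw [RCLike.conj_mul, hz]
      norm_num
    rcases eq_or_ne b 0 with rfl | hb
    · refine ⟨c, hc, fun z h1 => ?_⟩
      rw [Multiset.filter_cons_of_neg _ (by simp), ← h z h1]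
      simp only [Multiset.map_cons, Multiset.prod_cons, eval_mul, map_mul, Multiset.card_cons,
        pow_succ, eval_sub, eval_X, eval_C, sub_zero]
      linear_combination (conj ((s.map fun b => X - C b).prod.eval z) * z ^ Multiset.card s)
        * hz z h1
    · have hb' : conj b ≠ 0 := by simpa using hb
      refine ⟨-conj b * c, mul_ne_zero (neg_ne_zero.2 hb') hc, fun z h1 => ?_⟩
      rw [Multiset.filter_cons_of_pos (p := fun b : ℂ => b ≠ 0) _ hb]
      simp only [Multiset.map_cons, Multiset.prod_cons, eval_mul, map_mul, Multiset.card_cons,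
        pow_succ, eval_sub, eval_X, eval_C, map_sub]
      have h2 := h z h1
      have h3 : conj b * (1 / conj b) = 1 := mul_one_div_cancel hb'
      linear_combination (conj z * z - conj b * z) * h2
        + (c * (((s.filter fun b => b ≠ 0).map fun b => X - C (1 / conj b)).prod).eval z)
          * (hz z h1 - h3)

theorem exists_star_pc_inn (Q : ℂ[X]) : ∃ c : ℂ, c ≠ 0 ∧
    star (pc (inn Q)) * fourier (inn Q).natDegree = c • pc (ex (breve Q)) := by
  classical
  obtain ⟨c, hc, h⟩ := conj_prod_mul_pow (Q.roots.filter fun b => ‖b‖ < 1)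
  refine ⟨c, hc, ?_⟩
  have h1 : ex (breve Q) = (((Q.roots.filter fun b => ‖b‖ < 1).filter fun b => b ≠ 0).map
      fun b => X - C (1 / conj b)).prod := by
    have hb : (breve Q) = (((Q.roots.filter fun b => b ≠ 0).map fun b => 1 / conj b).map
        fun b => X - C b).prod := by
      rw [Multiset.map_map]
      simp only [breve, Function.comp_def]
    have h2 : (breve Q).leadingCoeff = 1 := by
      rw [hb]
      exact monic_multisetProd_X_sub_C _
    rw [ex, h2, C_1, one_mul, zeroPart, hb, roots_multiset_prod_X_sub_C, Multiset.filter_map,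
      Multiset.map_map, Multiset.filter_filter, Multiset.filter_filter]
    simp only [Function.comp_def]
    congr 2
    refine Multiset.filter_congr fun b _ => ?_
    rw [and_comm, and_congr_right_iff]
    intro hb0
    rw [norm_div, norm_one, RCLike.norm_conj, one_lt_div (norm_pos_iff.2 hb0)]
  have h3 : (inn Q).natDegree = Multiset.card (Q.roots.filter fun b => ‖b‖ < 1) := by
    rw [inn, zeroPart, natDegree_multiset_prod_X_sub_C_eq_card]
  ext x
  have := h (zc x) (norm_zc x)
  rw [← h1, ← h3] at this
  rw [ContinuousMap.smul_apply, pc_apply, smul_eq_mul, ← this, ContinuousMap.mul_apply,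
    ContinuousMap.star_apply, pc_apply, fourier_apply, AddCircle.toCircle_zsmul, zpow_natCast,
    Circle.coe_pow, zc, inn, zeroPart]
  congr!

theorem pc_ne_zero {Q : ℂ[X]} (h : ∀ b, Q.IsRoot b → ‖b‖ ≠ 1) (x : Torus) : pc Q x ≠ 0 := by
  rw [pc_apply]
  exact fun h0 => h _ h0 (norm_zc x)

theorem exists_cmul_pc_eq {Q : ℂ[X]} (h : ∀ b, Q.IsRoot b → ‖b‖ ≠ 1) (f : L2) :
    ∃ g, cmul (pc Q) g = f := by
  obtain ⟨ψ, hψ, -⟩ := exists_cmul_eq (pc_ne_zero h)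
  exact ⟨_, hψ f⟩

/-- The quotient exists in `L2` because `Q` has no zeros on the circle, and it stays in the Hardy
space by division. -/
theorem exists_cmul_pc_eq_of_one_lt {Q : ℂ[X]} (hQ : Q ≠ 0) (h : ∀ b, Q.IsRoot b → 1 < ‖b‖)
    {f : L2} (hf : f ∈ Low 0) : ∃ g ∈ Low 0, cmul (pc Q) g = f := by
  obtain ⟨g, rfl⟩ := exists_cmul_pc_eq (fun b hb => (h b hb).ne') f
  exact ⟨g, mem_Low_of_cmul hQ (fun b hb => (h b hb).le) hf, rfl⟩

/-! ### The graph of the Toeplitz operator -/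

theorem cmul_eq_cmul_iff {R S : ℂ[X]} (hS : S ≠ 0) {u w : L2} :
    cmul (pc S) w = cmul (pc R) u ↔ w =ᵐ[lam] fun x => ratFun R S x * u x := by
  constructor
  · intro h
    filter_upwards [ae_eval_ne_zero hS, cmul_ae (pc S) w, cmul_ae (pc R) u] with x h0 h1 h2
    rw [h, h2, pc_apply, pc_apply] at h1
    rw [ratFun, div_mul_eq_mul_div, h1, mul_div_cancel_left₀ _ h0]
  · intro h
    ext1
    filter_upwards [ae_eval_ne_zero hS, cmul_ae (pc S) w, cmul_ae (pc R) u, h] with x h0 h1 h2 h3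
    rw [h1, h2, h3, pc_apply, pc_apply, ratFun, div_mul_eq_mul_div, mul_div_cancel₀ _ h0]

theorem mem_graph_iff_exists {R S : ℂ[X]} (hS : S ≠ 0) {u v : H2} :
    (u, v) ∈ (toeplitz (ratFun R S)).graph ↔
      ∃ w : L2, cmul (pc S) w = cmul (pc R) u ∧ P w = v := by
  rw [LinearPMap.mem_graph_iff]
  constructor
  · rintro ⟨⟨u, hu⟩, rfl, rfl⟩
    exact ⟨_, (cmul_eq_cmul_iff hS).2 (MemLp.coeFn_toLp (hu : MemLp _ _ _)), rfl⟩
  · rintro ⟨w, hw, rfl⟩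
    rw [cmul_eq_cmul_iff hS] at hw
    have hu : MemLp (fun x => ratFun R S x * (u : L2) x) 2 lam := (Lp.memLp w).ae_eq hw
    refine ⟨⟨u, hu⟩, rfl, congrArg P ?_⟩
    exact Lp.ext ((MemLp.coeFn_toLp hu).trans hw.symm)

/-- Coprimality is what forces `u` to be divisible by the circle factor of `S` within the Hardy
space. -/
theorem cmul_eq_cmul_iff_exists_factor {R S : ℂ[X]} (hRS : IsCoprime R S) {u w : L2}
    (hu : u ∈ Low 0) :
    cmul (pc S) w = cmul (pc R) u ↔ ∃ g ∈ Low 0, u = cmul (pc (circ S)) g ∧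
      cmul (pc (inn S * ex S)) w = cmul (pc R) g := by
  have hS' : S = circ S * (inn S * ex S) := by
    rw [← mul_assoc]
    exact eq_circ_mul_inn_mul_ex S
  constructor
  · intro h
    obtain ⟨a, b, hab⟩ := hRS
    -- With `a R + b S = 1`, one gets `u = a R u + b S u = S (a w + b u)`.
    have hu' : u = cmul (pc (circ S)) (cmul (pc (inn S * ex S)) (cmul (pc a) w + cmul (pc b) u)) := by
      rw [← cmul_mul, ← pc_mul, ← hS', map_add, cmul_comm _ (pc a), h, ← cmul_mul, ← pc_mul,
        ← cmul_mul, ← pc_mul, ← cmul_add, mul_comm S]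
      simp only [pc, ← map_add, hab, map_one, cmul_one]
    refine ⟨_, ?_, hu', ?_⟩
    · rw [hu'] at hu
      exact mem_Low_of_cmul (circ_ne_zero S) (fun b hb => (norm_of_isRoot_circ hb).ge) hu
    · apply cmul_pc_injective (circ_ne_zero S)
      rw [cmul_comm (pc (circ S)) (pc R), ← hu', ← h, ← cmul_mul, ← pc_mul, ← hS']
  · rintro ⟨g, -, rfl, h⟩
    rw [cmul_comm (pc R), ← h, ← cmul_mul, ← pc_mul, ← hS']

theorem mem_graph_iff_exists_factor {R S : ℂ[X]} (hS : S ≠ 0) (hRS : IsCoprime R S) {u v : H2} :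
    (u, v) ∈ (toeplitz (ratFun R S)).graph ↔
      ∃ g ∈ Low 0, ∃ w : L2, (u : L2) = cmul (pc (circ S)) g ∧
        cmul (pc (inn S * ex S)) w = cmul (pc R) g ∧ P w = v := by
  rw [mem_graph_iff_exists hS]
  constructor
  · rintro ⟨w, h, hv⟩
    obtain ⟨g, hg, h1, h2⟩ := (cmul_eq_cmul_iff_exists_factor hRS (mem_H2.1 u.2)).1 h
    exact ⟨g, hg, w, h1, h2, hv⟩
  · rintro ⟨g, hg, w, h1, h2, hv⟩
    exact ⟨w, (cmul_eq_cmul_iff_exists_factor hRS (mem_H2.1 u.2)).2 ⟨g, hg, h1, h2⟩, hv⟩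

/-- The factor `S_ex` is invertible on the Hardy space, so it can be absorbed by `g = S_ex k`. Only
`S_in` remains as a denominator. -/
theorem mem_graph_iff_exists_inn {R S : ℂ[X]} (hS : S ≠ 0) (hRS : IsCoprime R S) {u v : H2} :
    (u, v) ∈ (toeplitz (ratFun R S)).graph ↔
      ∃ k ∈ Low 0, ∃ w : L2, (u : L2) = cmul (pc (circ S * ex S)) k ∧
        cmul (pc (inn S)) w = cmul (pc R) k ∧ P w = v := by
  rw [mem_graph_iff_exists_factor hS hRS]
  constructor
  · rintro ⟨g, hg, w, h1, h2, hv⟩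
    obtain ⟨k, hk, rfl⟩ := exists_cmul_pc_eq_of_one_lt (ex_ne_zero hS)
      (fun b => norm_of_isRoot_ex hS) hg
    refine ⟨k, hk, w, by rw [h1, pc_mul, cmul_mul], ?_, hv⟩
    apply cmul_pc_injective (ex_ne_zero hS)
    rw [← cmul_mul, ← pc_mul, mul_comm, h2, cmul_comm]
  · rintro ⟨k, hk, w, h1, h2, hv⟩
    refine ⟨_, cmul_mem_Low (ex_ne_zero hS) hk, w, by rw [h1, pc_mul, cmul_mul], ?_, hv⟩
    rw [mul_comm, pc_mul, cmul_mul, h2, cmul_comm]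

theorem mem_pran_iff {T : H2 →ₗ.[ℂ] H2} {v : H2} : v ∈ pran T ↔ ∃ u, (u, v) ∈ T.graph := by
  constructor
  · rintro ⟨u, rfl⟩
    exact ⟨u, T.mem_graph u⟩
  · rintro ⟨u, h⟩
    obtain ⟨u', -, h⟩ := LinearPMap.mem_graph_iff _ |>.1 h
    exact ⟨u', h⟩

theorem mem_pker_iff {T : H2 →ₗ.[ℂ] H2} {u : H2} : u ∈ pker T ↔ (u, 0) ∈ T.graph := by
  rw [LinearPMap.mem_graph_iff]
  constructor
  · rintro ⟨u', h, rfl⟩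
    exact ⟨u', rfl, h⟩
  · rintro ⟨u', rfl, h⟩
    exact ⟨u', h, rfl⟩

/-! ### Closedness, domain and range -/

/-- A pair `(u, v)` is in the graph iff `R u - S v` lies in `S · High 0`. Since it always lies in
`Low 0`, only a finite-dimensional, hence closed, space `F` matters, and the graph is its preimage
under a continuous map. -/
theorem isClosed_toeplitz (R : ℂ[X]) {S : ℂ[X]} (hS : S ≠ 0) :
    (toeplitz (ratFun R S)).IsClosed := by
  let F : Submodule ℂ L2 := (High 0).map (cmul (pc S)).toLinearMap ⊓ Low 0
  have hF : F ≤ Low 0 ⊓ High (0 + S.natDegree) := by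
    rintro _ ⟨⟨h, hh, rfl⟩, h2⟩
    exact ⟨h2, cmul_mem_High hS hh⟩
  have : FiniteDimensional ℂ F := Submodule.finiteDimensional_of_le hF
  have hF' : IsClosed (F : Set L2) := F.closed_of_finiteDimensional
  have hc : Continuous fun p : H2 × H2 => cmul (pc R) p.1 - cmul (pc S) p.2 := by fun_prop
  have hE : ((toeplitz (ratFun R S)).graph : Set (H2 × H2))
      = (fun p : H2 × H2 => cmul (pc R) p.1 - cmul (pc S) p.2) ⁻¹' F := by
    ext ⟨u, v⟩
    rw [SetLike.mem_coe, mem_graph_iff_exists hS, Set.mem_preimage]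
    constructor
    · rintro ⟨w, hw, hv⟩
      have h0 : ∀ f : H2, ∀ Q : ℂ[X], cmul (pc Q) f ∈ Low 0 := fun f Q => by
        rcases eq_or_ne Q 0 with rfl | hQ
        · simp [pc, cmul]
        · exact cmul_mem_Low hQ (mem_H2.1 f.2)
      refine ⟨⟨w - v, P_eq_iff.1 hv, ?_⟩, (Low 0).sub_mem (h0 _ _) (h0 _ _)⟩
      simp [hw]
    · rintro ⟨⟨h, hh, hw⟩, -⟩
      refine ⟨v + h, ?_, P_eq_iff.2 (by simpa using hh)⟩
      rw [map_add]
      exact (sub_eq_iff_eq_add'.1 hw.symm).symm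
  rw [LinearPMap.IsClosed, hE]
  exact hF'.preimage hc

theorem mem_domain_iff_exists {R S : ℂ[X]} (hS : S ≠ 0) (hRS : IsCoprime R S)
    {u : H2} : u ∈ (toeplitz (ratFun R S)).domain ↔
      ∃ g ∈ Low 0, (u : L2) = cmul (pc (circ S)) g := by
  rw [LinearPMap.mem_domain_iff]
  constructor
  · rintro ⟨v, h⟩
    obtain ⟨g, hg, -, h, -⟩ := (mem_graph_iff_exists_factor hS hRS).1 h
    exact ⟨g, hg, h⟩
  · rintro ⟨g, hg, h⟩
    obtain ⟨w, hw⟩ := exists_cmul_pc_eq (fun b => norm_ne_of_isRoot_inn_mul_ex hS (b := b))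
      (cmul (pc R) g)
    exact ⟨P w, (mem_graph_iff_exists_factor hS hRS).2 ⟨g, hg, w, h, hw, rfl⟩⟩

theorem forall_inner_eq_zero_iff {f : L2} : (∀ g ∈ Low 0, inner ℂ g f = 0) ↔ f ∈ High 0 := by
  rw [← orthogonal_H2, Submodule.mem_orthogonal, H2_eq_Low]

/-- If `f` is orthogonal to `Q H2`, then `conj Q f` lies in `High 0`; division puts `f` itself
there, so `f = 0`. -/
theorem dense_of_cmul_mem {Q : ℂ[X]} (hQ : Q ≠ 0) (hr : ∀ b, Q.IsRoot b → 1 ≤ ‖b‖)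
    {K : Submodule ℂ H2} (hK : ∀ g ∈ Low 0, ∃ u ∈ K, (u : L2) = cmul (pc Q) g) :
    Dense (K : Set H2) := by
  rw [Submodule.dense_iff_topologicalClosure_eq_top, Submodule.topologicalClosure_eq_top_iff,
    Submodule.eq_bot_iff]
  intro f hf
  have h : (f : L2) ∈ High 0 := by
    refine mem_High_of_cmul_star hQ hr (forall_inner_eq_zero_iff.1 fun g hg => ?_)
    obtain ⟨u, hu, h⟩ := hK g hg
    rw [inner_cmul, star_star, ← h]
    exact (Submodule.mem_orthogonal _ _).1 hf u hu
  exact Subtype.ext (eq_zero_of_mem_Low_of_mem_High le_rfl (mem_H2.1 f.2) h)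

theorem dense_domain {R S : ℂ[X]} (hS : S ≠ 0) (hRS : IsCoprime R S) :
    Dense ((toeplitz (ratFun R S)).domain : Set H2) :=
  dense_of_cmul_mem (circ_ne_zero S) (fun _ hb => (norm_of_isRoot_circ hb).ge) fun g hg =>
    ⟨⟨_, mem_H2.2 (cmul_mem_Low (circ_ne_zero S) hg)⟩,
      (mem_domain_iff_exists hS hRS).2 ⟨g, hg, rfl⟩, rfl⟩

theorem image_domain_eq {R S : ℂ[X]} (hS : S ≠ 0) (hRS : IsCoprime R S) :
    (Subtype.val '' ((toeplitz (ratFun R S)).domain : Set H2) : Set L2)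
      = mulH2 (fun x => (circ S).eval (zc x)) := by
  have h : ∀ f g : L2, f = cmul (pc (circ S)) g ↔
      f =ᵐ[lam] fun x => (circ S).eval (zc x) * g x := fun f g => by
    have h1 : (cmul (pc (circ S)) g : L2) =ᵐ[lam] fun x => (circ S).eval (zc x) * g x := by
      simpa only [pc_apply] using cmul_ae (pc (circ S)) g
    exact ⟨fun h => h ▸ h1, fun h => Lp.ext (h.trans h1.symm)⟩
  ext f
  constructor
  · rintro ⟨u, hu, rfl⟩
    obtain ⟨g, hg, hu⟩ := (mem_domain_iff_exists hS hRS).1 hu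
    exact ⟨g, mem_H2.2 hg, (h _ _).1 hu⟩
  · rintro ⟨g, hg, hf⟩
    rw [← h] at hf
    rw [mem_H2] at hg
    refine ⟨⟨f, ?_⟩, (mem_domain_iff_exists hS hRS).2 ⟨g, hg, hf⟩, rfl⟩
    rw [hf, mem_H2]
    exact cmul_mem_Low (circ_ne_zero S) hg

theorem pran_eq {R S : ℂ[X]} (hS : S ≠ 0) (hRS : IsCoprime R S) :
    (pran (toeplitz (ratFun R S)) : Set H2) = P '' mulH2 (ratFun R (inn S * ex S)) := by
  have h0 : inn S * ex S ≠ 0 := mul_ne_zero (inn_ne_zero S) (ex_ne_zero hS)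
  ext v
  rw [SetLike.mem_coe, mem_pran_iff]
  constructor
  · rintro ⟨u, h⟩
    obtain ⟨g, hg, w, -, h, hv⟩ := (mem_graph_iff_exists_factor hS hRS).1 h
    exact ⟨w, ⟨g, mem_H2.2 hg, (cmul_eq_cmul_iff h0).1 h⟩, hv⟩
  · rintro ⟨w, ⟨g, hg, h⟩, hv⟩
    rw [mem_H2] at hg
    exact ⟨⟨_, mem_H2.2 (cmul_mem_Low (circ_ne_zero S) hg)⟩,
      (mem_graph_iff_exists_factor hS hRS).2 ⟨g, hg, w, rfl, (cmul_eq_cmul_iff h0).2 h, hv⟩⟩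

theorem mem_pran_toeplitz_iff {R S : ℂ[X]} (hS : S ≠ 0) (hRS : IsCoprime R S) {v : H2} :
    v ∈ pran (toeplitz (ratFun R S)) ↔
      ∃ k ∈ Low 0, ∃ w : L2, cmul (pc (inn S)) w = cmul (pc R) k ∧ P w = v := by
  rw [mem_pran_iff]
  constructor
  · rintro ⟨u, h⟩
    obtain ⟨k, hk, w, -, h⟩ := (mem_graph_iff_exists_inn hS hRS).1 h
    exact ⟨k, hk, w, h⟩
  · rintro ⟨k, hk, w, h⟩
    exact ⟨⟨_, mem_H2.2 (cmul_mem_Low (mul_ne_zero (circ_ne_zero S) (ex_ne_zero hS)) hk)⟩,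
      (mem_graph_iff_exists_inn hS hRS).2 ⟨k, hk, w, rfl, h⟩⟩

/-! ### The kernel -/

theorem polyL2_zero_ae (t : ℂ[X]) : (polyL2 0 t : L2) =ᵐ[lam] fun x => t.eval (zc x) := by
  simpa using polyL2_ae 0 t

theorem mem_polyMul_iff {A B : ℂ[X]} (hB : B ≠ 0) {d : ℤ} {f : L2} :
    f ∈ polyMul (ratFun A B) d ↔ ∃ t : ℂ[X], (t = 0 ∨ (t.natDegree : ℤ) < d) ∧
      cmul (pc B) f = cmul (pc A) (polyL2 0 t) := by
  refine exists_congr fun t => and_congr_right fun _ => ?_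
  rw [cmul_eq_cmul_iff hB]
  have h := polyL2_zero_ae t
  constructor
  · intro hf
    filter_upwards [h, hf] with x h1 h2
    rw [h1, h2]
  · intro hf
    filter_upwards [h, hf] with x h1 h2
    rw [h2, h1]

theorem image_pker_eq {R S : ℂ[X]} (hR : R ≠ 0) (hS : S ≠ 0) (hRS : IsCoprime R S) :
    (Subtype.val '' (pker (toeplitz (ratFun R S)) : Set H2) : Set L2)
      = polyMul (ratFun (circ S * ex S) (ex R))
          (((inn S).natDegree : ℤ) - ((circ R * inn R).natDegree : ℤ)) := by
  have h0 : circ S * ex S ≠ 0 := mul_ne_zero (circ_ne_zero S) (ex_ne_zero hS)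
  have h1 : circ R * inn R ≠ 0 := mul_ne_zero (circ_ne_zero R) (inn_ne_zero R)
  have hR' : ∀ k, cmul (pc R) k = cmul (pc (circ R * inn R)) (cmul (pc (ex R)) k) := fun k => by
    rw [← cmul_mul, ← pc_mul, ← eq_circ_mul_inn_mul_ex]
  ext f
  rw [mem_polyMul_iff (ex_ne_zero hR)]
  constructor
  · rintro ⟨u, hu, rfl⟩
    obtain ⟨k, hk, w, hu, hw, hP⟩ := (mem_graph_iff_exists_inn hS hRS).1 (mem_pker_iff.1 hu)
    have hw0 : w ∈ High 0 := by simpa using P_eq_iff.1 hP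
    -- `R k = S_in w` has spectrum below `deg S_in`; dividing by the factor of `R` with zeros in the
    -- closed disc lowers this bound by its degree.
    have hτ : cmul (pc (ex R)) k
        ∈ High (((inn S).natDegree : ℤ) - ((circ R * inn R).natDegree : ℤ)) := by
      refine mem_High_of_cmul h1 (fun b => norm_of_isRoot_circ_mul_inn) ?_
      rw [← hR', ← hw, sub_add_cancel, ← zero_add ((inn S).natDegree : ℤ)]
      exact cmul_mem_High (inn_ne_zero S) hw0
    obtain ⟨t, ht, h⟩ := exists_eq_polyL2 (cmul_mem_Low (ex_ne_zero hR) hk) hτ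
    rw [sub_zero] at ht
    exact ⟨t, ht, by rw [hu, cmul_comm, h]⟩
  · rintro ⟨t, ht, hf⟩
    obtain ⟨k, hk, hkt⟩ := exists_cmul_pc_eq_of_one_lt (ex_ne_zero hR)
      (fun b => norm_of_isRoot_ex hR) (polyL2_mem_Low 0 t)
    have hf' : f = cmul (pc (circ S * ex S)) k := by
      apply cmul_pc_injective (ex_ne_zero hR)
      rw [hf, ← hkt, cmul_comm]
    obtain ⟨w, hw⟩ := exists_cmul_pc_eq (fun b hb => (norm_of_isRoot_inn (Q := S) hb).ne)
      (cmul (pc R) k)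
    have hw0 : w ∈ High 0 := by
      refine mem_High_of_cmul (inn_ne_zero S) (fun b hb => (norm_of_isRoot_inn hb).le) ?_
      rw [hw, hR', hkt]
      have := cmul_mem_High h1 (polyL2_mem_High (n := 0) (by rwa [sub_zero]))
      rwa [sub_add_cancel, ← zero_add ((inn S).natDegree : ℤ)] at this
    have hfH : f ∈ H2 := by
      rw [hf', mem_H2]
      exact cmul_mem_Low h0 hk
    exact ⟨⟨f, hfH⟩, mem_pker_iff.2 ((mem_graph_iff_exists_inn hS hRS).2
      ⟨k, hk, w, hf', hw, P_eq_iff.2 (by simpa using hw0)⟩), rfl⟩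

/-! ### The orthogonal complement of the range -/

theorem exists_cmul_star_pc_eq {Q : ℂ[X]} (h : ∀ b, Q.IsRoot b → ‖b‖ ≠ 1) (f : L2) :
    ∃ g, cmul (star (pc Q)) g = f := by
  obtain ⟨ψ, hψ, -⟩ := exists_cmul_eq (φ := star (pc Q)) fun x => by
    simpa using pc_ne_zero h x
  exact ⟨_, hψ f⟩

theorem cmul_star_pc_injective {Q : ℂ[X]} (h : ∀ b, Q.IsRoot b → ‖b‖ ≠ 1) :
    Function.Injective (cmul (star (pc Q))) := by
  obtain ⟨ψ, -, hψ⟩ := exists_cmul_eq (φ := star (pc Q)) fun x => by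
    simpa using pc_ne_zero h x
  exact Function.LeftInverse.injective hψ

/-- Conjugates of factors with zeros of modulus at least 1 can be both multiplied in and cancelled
in `High 0`. This is why zeros of `R` on the circle do not affect the complement of the range. -/
theorem cmul_star_mem_High_iff {R : ℂ[X]} (hR : R ≠ 0) {x : L2} :
    cmul (star (pc R)) x ∈ High 0 ↔ cmul (star (pc (inn R))) x ∈ High 0 := by
  have h0 : circ R * ex R ≠ 0 := mul_ne_zero (circ_ne_zero R) (ex_ne_zero hR)
  have h : cmul (star (pc R)) x
      = cmul (star (pc (circ R * ex R))) (cmul (star (pc (inn R))) x) := by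
    rw [← cmul_mul]
    conv_lhs => rw [eq_circ_mul_inn_mul_ex R, mul_right_comm, pc_mul, star_mul']
  rw [h]
  exact ⟨mem_High_of_cmul_star h0 fun b => norm_of_isRoot_circ_mul_ex hR, cmul_star_mem_High h0⟩

/-- With `f = conj(S_in) x`, moving factors across the inner product gives `⟨w, f⟩ = ⟨S_in w, x⟩ =
⟨R k, x⟩ = ⟨k, conj(R) x⟩`. No coprimality is needed, so it applies also after `R` is replaced by a
divisor. -/
theorem forall_inner_eq_zero_iff_exists {R S : ℂ[X]} (hR : R ≠ 0) {f : L2} :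
    (∀ k ∈ Low 0, ∀ w : L2, cmul (pc (inn S)) w = cmul (pc R) k → inner ℂ w f = 0) ↔
      ∃ x : L2, cmul (star (pc (inn S))) x = f ∧ cmul (star (pc (inn R))) x ∈ High 0 := by
  have hinn : ∀ b, (inn S).IsRoot b → ‖b‖ ≠ 1 := fun b hb => (norm_of_isRoot_inn hb).ne
  have key : ∀ x k w : L2, cmul (pc (inn S)) w = cmul (pc R) k →
      inner ℂ w (cmul (star (pc (inn S))) x) = inner ℂ k (cmul (star (pc R)) x) :=
    fun x k w h => by rw [inner_cmul, star_star, h, inner_cmul, star_star]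
  constructor
  · intro h
    obtain ⟨x, rfl⟩ := exists_cmul_star_pc_eq hinn f
    refine ⟨x, rfl, (cmul_star_mem_High_iff hR).1 (forall_inner_eq_zero_iff.1 fun k hk => ?_)⟩
    obtain ⟨w, hw⟩ := exists_cmul_pc_eq hinn (cmul (pc R) k)
    rw [← key x k w hw, h k hk w hw]
  · rintro ⟨x, rfl, hx⟩ k hk w hw
    rw [key x k w hw]
    exact forall_inner_eq_zero_iff.2 ((cmul_star_mem_High_iff hR).2 hx) k hk

theorem mem_orthogonal_pran_iff {R S : ℂ[X]} (hR : R ≠ 0) (hS : S ≠ 0) (hRS : IsCoprime R S)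
    {f : H2} : f ∈ (pran (toeplitz (ratFun R S)))ᗮ ↔
      ∃ x : L2, cmul (star (pc (inn S))) x = f ∧ cmul (star (pc (inn R))) x ∈ High 0 := by
  rw [← forall_inner_eq_zero_iff_exists hR, Submodule.mem_orthogonal]
  constructor
  · intro h k hk w hw
    rw [← inner_P]
    exact h _ ((mem_pran_toeplitz_iff hS hRS).2 ⟨k, hk, w, hw, rfl⟩)
  · intro h v hv
    obtain ⟨k, hk, w, hw, rfl⟩ := (mem_pran_toeplitz_iff hS hRS).1 hv
    rw [inner_P]
    exact h k hk w hw

theorem cmul_fourier_polyL2 (i n : ℤ) (t : ℂ[X]) :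
    cmul (fourier i) (polyL2 n t) = polyL2 (i + n) t := by
  rw [polyL2, cmul_comm, cmul_fourierLp, polyL2]

theorem polyL2_C_mul (n : ℤ) (c : ℂ) (t : ℂ[X]) : polyL2 n (C c * t) = c • polyL2 n t := by
  rw [polyL2, pc_mul, cmul_mul, cmul_pc_C, polyL2]

theorem breve_ne_zero (Q : ℂ[X]) : breve Q ≠ 0 := by
  classical
  refine Multiset.prod_ne_zero fun h => ?_
  obtain ⟨b, -, hb⟩ := Multiset.mem_map.1 h
  exact X_sub_C_ne_zero _ hb

theorem cmul_fourier_cmul_fourier_neg (i : ℤ) (f : L2) :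
    cmul (fourier i) (cmul (fourier (-i)) f) = f :=
  coef_ext fun j => by rw [coef_cmul_fourier, coef_cmul_fourier, sub_neg_eq_add, sub_add_cancel]

theorem cmul_eq_of_mul_fourier_eq {φ ψ : C(Torus, ℂ)} {c : ℂ} {m : ℤ}
    (h : φ * fourier m = c • ψ) (f : L2) :
    cmul φ f = c • cmul (fourier (-m)) (cmul ψ f) := by
  rw [cmul_comm, ← cmul_smul, ← h, cmul_mul, cmul_fourier_cmul_fourier_neg]

theorem image_orthogonal_pran_eq {R S : ℂ[X]} (hR : R ≠ 0) (hS : S ≠ 0) (hRS : IsCoprime R S) :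
    (Subtype.val '' ((pran (toeplitz (ratFun R S)))ᗮ : Set H2) : Set L2)
      = polyMul (ratFun (ex (breve S)) (ex (breve R)))
          (((inn R).natDegree : ℤ) - ((inn S).natDegree : ℤ)) := by
  obtain ⟨a, ha, hRa⟩ := exists_star_pc_inn R
  obtain ⟨b, hb, hSb⟩ := exists_star_pc_inn S
  have hB : ex (breve R) ≠ 0 := ex_ne_zero (breve_ne_zero R)
  have hinnS : ∀ b, (inn S).IsRoot b → ‖b‖ ≠ 1 := fun b hb => (norm_of_isRoot_inn hb).ne
  set m : ℤ := ((inn R).natDegree : ℤ)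
  set n : ℤ := ((inn S).natDegree : ℤ) with hn
  -- Multiplication by `z ^ m` turns `conj(R_in)` and `z ^ n conj(S_in)` into multiples of the
  -- reflected polynomials; `a` and `b` are the resulting constants.
  have key : ∀ (f : L2) (t : ℂ[X]),
      cmul (star (pc (inn R))) f = cmul (star (pc (inn S))) (polyL2 (n - m) t) ↔
        a • cmul (pc (ex (breve R))) f = b • cmul (pc (ex (breve S))) (polyL2 0 t) := fun f t => by
    have h1 : polyL2 (n - m) t = cmul (fourier n) (cmul (fourier (-m)) (polyL2 0 t)) := by
      rw [cmul_fourier_polyL2, cmul_fourier_polyL2, add_zero, sub_eq_add_neg]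
    have h2 : cmul (star (pc (inn S))) (polyL2 (n - m) t)
        = b • cmul (fourier (-m)) (cmul (pc (ex (breve S))) (polyL2 0 t)) := by
      rw [h1, ← cmul_mul, hSb, cmul_smul, cmul_comm]
    rw [cmul_eq_of_mul_fourier_eq hRa, h2, ← map_smul (cmul (fourier (-m))),
      ← map_smul (cmul (fourier (-m)))]
    exact (Function.LeftInverse.injective (cmul_fourier_cmul_fourier_neg m)).eq_iff
  ext f
  rw [mem_polyMul_iff hB]
  constructor
  · rintro ⟨f, hf, rfl⟩
    obtain ⟨x, hx, hx0⟩ := (mem_orthogonal_pran_iff hR hS hRS).1 hf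
    -- Since `conj(S_in) x = f` has no negative frequencies, division gives the lower bound `n` for
    -- `x`; then `conj(R_in) x` lies in `Low (n - m) ⊓ High 0`.
    have hxl : x ∈ Low n := by
      refine mem_Low_of_cmul_star (inn_ne_zero S) (fun b hb => (norm_of_isRoot_inn hb).le) ?_
      rw [hx, ← hn, sub_self]
      exact mem_H2.1 f.2
    obtain ⟨t, ht, h⟩ := exists_eq_polyL2 (cmul_star_mem_Low (inn_ne_zero R) hxl) hx0
    have h1 := (key f t).1 (by rw [← hx, cmul_comm, h])
    refine ⟨C (b / a) * t, ?_, ?_⟩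
    · rw [natDegree_C_mul (div_ne_zero hb ha)]
      exact ht.imp (fun h => by rw [h, mul_zero]) fun h => by omega
    · rw [polyL2_C_mul, map_smul, div_eq_inv_mul, mul_smul, ← h1, inv_smul_smul₀ ha]
  · rintro ⟨t, ht, h⟩
    have hf : f ∈ Low 0 := by
      refine mem_Low_of_cmul hB (fun c hc => (norm_of_isRoot_ex (breve_ne_zero R) hc).le) ?_
      rw [h]
      exact cmul_mem_Low (ex_ne_zero (breve_ne_zero S)) (polyL2_mem_Low 0 t)
    obtain ⟨x, hx⟩ := exists_cmul_star_pc_eq hinnS f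
    have h1 := (key f (C (a / b) * t)).2 (by
      rw [h, polyL2_C_mul, map_smul, smul_smul, mul_div_cancel₀ _ hb])
    refine ⟨⟨f, mem_H2.2 hf⟩, (mem_orthogonal_pran_iff hR hS hRS).2 ⟨x, hx, ?_⟩, rfl⟩
    rw [← hx, cmul_comm] at h1
    rw [cmul_star_pc_injective hinnS h1]
    refine polyL2_mem_High ?_
    rw [natDegree_C_mul (div_ne_zero ha hb)]
    exact ht.imp (fun h => by rw [h, mul_zero]) fun h => by omega

/-! ### The Fredholm property -/

/-- The quotient `E ⧸ K` is isomorphic to `Kᗮ`, so the image of `N` in it is closed, and `N` is the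
preimage of that image. -/
theorem isClosed_and_finiteDimensional_quotient {E : Type*} [NormedAddCommGroup E]
    [InnerProductSpace ℂ E] [CompleteSpace E] {K N : Submodule ℂ E} (hK : IsClosed (K : Set E))
    [FiniteDimensional ℂ Kᗮ] (hKN : K ≤ N) :
    IsClosed (N : Set E) ∧ FiniteDimensional ℂ (E ⧸ N) := by
  have : CompleteSpace K := hK.completeSpace_coe
  have hq : FiniteDimensional ℂ (E ⧸ K) :=
    (K.quotientEquivOfIsCompl Kᗮ K.isCompl_orthogonal).symm.finiteDimensional
  refine ⟨?_, Module.Finite.of_surjective (Submodule.factor hKN) (Submodule.factor_surjective hKN)⟩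
  have h1 : IsClosed (N.map K.mkQ : Set (E ⧸ K)) := Submodule.closed_of_finiteDimensional _
  have h2 : (N : Set E) = K.mkQ ⁻¹' (N.map K.mkQ : Set (E ⧸ K)) := by
    rw [← Submodule.comap_coe, Submodule.comap_map_mkQ, sup_eq_right.2 hKN]
  rw [h2]
  exact h1.preimage continuous_quot_mk

theorem finiteDimensional_of_cmul_mem {V : Submodule ℂ H2} {φ : C(Torus, ℂ)}
    (hφ : Function.Injective (cmul φ)) {m n : ℤ}
    (h : ∀ u ∈ V, cmul φ (u : L2) ∈ (Low m ⊓ High n : Submodule ℂ L2)) :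
    FiniteDimensional ℂ V := by
  let Φ : V →ₗ[ℂ] (Low m ⊓ High n : Submodule ℂ L2) :=
    ((cmul φ).toLinearMap ∘ₗ H2.subtype ∘ₗ V.subtype).codRestrict _ fun u => h u u.2
  refine FiniteDimensional.of_injective Φ fun u v huv => ?_
  exact Subtype.ext (Subtype.ext (hφ (congrArg Subtype.val huv)))

theorem finiteDimensional_pker {R S : ℂ[X]} (hR : R ≠ 0) (hS : S ≠ 0) (hRS : IsCoprime R S) :
    FiniteDimensional ℂ (pker (toeplitz (ratFun R S))) := by
  have h0 : circ S * ex S ≠ 0 := mul_ne_zero (circ_ne_zero S) (ex_ne_zero hS)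
  refine finiteDimensional_of_cmul_mem (cmul_pc_injective (ex_ne_zero hR)) (m := 0)
    (n := ((inn S).natDegree : ℤ) - ((circ R * inn R).natDegree : ℤ)
      + (circ S * ex S).natDegree) fun u hu => ?_
  have hu' : (u : L2) ∈ polyMul _ _ := image_pker_eq hR hS hRS ▸ Set.mem_image_of_mem _ hu
  obtain ⟨t, ht, h⟩ := (mem_polyMul_iff (ex_ne_zero hR)).1 hu'
  rw [h]
  exact ⟨cmul_mem_Low h0 (polyL2_mem_Low 0 t),
    cmul_mem_High h0 (polyL2_mem_High (by rwa [sub_zero]))⟩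

theorem isClosed_pran_and_finiteDimensional {R S : ℂ[X]} (hR : R ≠ 0) (hS : S ≠ 0)
    (hRS : IsCoprime R S) (h : ∀ a : ℂ, ‖a‖ = 1 → R.eval a ≠ 0) :
    IsClosed (pran (toeplitz (ratFun R S)) : Set H2) ∧
      FiniteDimensional ℂ (H2 ⧸ pran (toeplitz (ratFun R S))) := by
  have hinn : ∀ b, (inn R).IsRoot b → ‖b‖ ≠ 1 := fun b hb => (norm_of_isRoot_inn hb).ne
  have hR' : R = inn R * ex R := by
    conv_lhs => rw [eq_circ_mul_inn_mul_ex R, circ_eq_one h, one_mul]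
  obtain ⟨ψ, hψ, hψ'⟩ := exists_cmul_eq (pc_ne_zero hinn)
  -- This is `R_in H2`, described as the `v` with `v / R_in` in `H2` so that closedness is
  -- immediate.
  let K : Submodule ℂ H2 := (Low 0).comap ((cmul ψ).toLinearMap ∘ₗ H2.subtype)
  have hKc : IsClosed (K : Set H2) :=
    (isClosed_Low 0).preimage ((cmul ψ).continuous.comp continuous_subtype_val)
  have : FiniteDimensional ℂ Kᗮ := by
    refine finiteDimensional_of_cmul_mem (cmul_star_pc_injective hinn)
      (m := 0 - (inn R).natDegree) (n := 0) fun f hf => ⟨?_, ?_⟩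
    · exact cmul_star_mem_Low (inn_ne_zero R) (mem_H2.1 f.2)
    · refine forall_inner_eq_zero_iff.1 fun g hg => ?_
      rw [inner_cmul, star_star]
      refine (Submodule.mem_orthogonal _ _).1 hf
        ⟨_, mem_H2.2 (cmul_mem_Low (inn_ne_zero R) hg)⟩ ?_
      change cmul ψ (cmul (pc (inn R)) g) ∈ Low 0
      rwa [hψ']
  refine isClosed_and_finiteDimensional_quotient hKc fun v hv => ?_
  obtain ⟨k, hk, hkv⟩ := exists_cmul_pc_eq_of_one_lt (ex_ne_zero hR)
    (fun b => norm_of_isRoot_ex hR) (cmul_mem_Low (inn_ne_zero S) hv)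
  -- For `v = R_in h`, choose `k` with `R_ex k = S_in h`; then `S_in v = R k`, so `w = v` serves and
  -- the projection does nothing.
  refine (mem_pran_toeplitz_iff hS hRS).2 ⟨k, hk, v, ?_, P_eq_iff.2 (by simp)⟩
  conv_rhs => rw [hR', pc_mul, cmul_mul, hkv]
  rw [cmul_comm]
  exact congrArg _ (hψ v).symm

/-- Otherwise the injective operator `D` of multiplication by `z - a` on `H2` would have a
one-dimensional algebraic complement, hence closed range. Its range is dense, so it would be
everything, but it misses the constant 1. -/
theorem exists_not_mem_range_X_sub_C {a : ℂ} (ha : ‖a‖ = 1) : ∃ G ∈ Low 0, ¬ ∃ c : ℂ, ∃ g ∈ Low 0,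
    G = c • (fourierLp 2 0 : L2) + cmul (pc (X - C a)) g := by
  by_contra! hcon
  have h0 : X - C a ≠ 0 := X_sub_C_ne_zero a
  have hroot : ∀ b, (X - C a).IsRoot b → ‖b‖ = 1 := fun b hb => by
    rw [root_X_sub_C] at hb
    rw [← hb, ha]
  let D : H2 →L[ℂ] H2 := ((cmul (pc (X - C a))).comp H2.subtypeL).codRestrict H2 fun u =>
    mem_H2.2 (cmul_mem_Low h0 (mem_H2.1 u.2))
  let e : H2 := ⟨fourierLp 2 0, mem_H2.2 (fourierLp_mem_Low 0)⟩
  have he : e ≠ 0 := fun h => by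
    have h1 := coef_fourierLp 0 0
    rw [show (fourierLp 2 0 : L2) = 0 from congrArg Subtype.val h, coef_zero] at h1
    simp at h1
  have heD : e ∉ D.range := by
    rintro ⟨g, hg⟩
    have hg' : cmul (pc (X - C a)) (g : L2) = fourierLp 2 0 := congrArg Subtype.val hg
    have hgh : (g : L2) ∈ High 0 := by
      refine mem_High_of_cmul h0 (fun b hb => (hroot b hb).le) ?_
      rw [hg', natDegree_X_sub_C]
      exact fourierLp_mem_High 0
    have : g = 0 := Subtype.ext (eq_zero_of_mem_Low_of_mem_High le_rfl (mem_H2.1 g.2) hgh)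
    rw [this, map_zero] at hg
    exact he hg.symm
  have hcompl : IsCompl D.range (ℂ ∙ e) := by
    refine ⟨(Submodule.disjoint_span_singleton' he).2 heD, codisjoint_iff.2 ?_⟩
    rw [eq_top_iff]
    intro G _
    obtain ⟨c, g, hg, h⟩ := hcon G (mem_H2.1 G.2)
    rw [Submodule.mem_sup]
    refine ⟨D ⟨g, mem_H2.2 hg⟩, ⟨_, rfl⟩, c • e, Submodule.smul_mem _ _
      (Submodule.mem_span_singleton_self e), Subtype.ext ?_⟩
    rw [h, add_comm]
    rfl
  have hker : D.ker = ⊥ := by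
    refine LinearMap.ker_eq_bot.2 fun u v huv => ?_
    exact Subtype.ext (cmul_pc_injective h0 (congrArg Subtype.val huv))
  have hclosed := D.closed_complemented_range_of_isCompl_of_ker_eq_bot _ hcompl
    (Submodule.closed_of_finiteDimensional _) hker
  have hdense : Dense (D.range : Set H2) :=
    dense_of_cmul_mem h0 (fun b hb => (hroot b hb).ge) fun g hg =>
      ⟨D ⟨g, mem_H2.2 hg⟩, ⟨_, rfl⟩, rfl⟩
  have huniv := hdense.closure_eq
  rw [hclosed.closure_eq] at huniv
  exact heD (huniv ▸ Set.mem_univ e : e ∈ (D.range : Set H2))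

theorem eval_ne_zero_of_isClosed_pran {R S : ℂ[X]} (hR : R ≠ 0) (hS : S ≠ 0)
    (hRS : IsCoprime R S) (h : IsClosed (pran (toeplitz (ratFun R S)) : Set H2)) {a : ℂ}
    (ha : ‖a‖ = 1) : R.eval a ≠ 0 := by
  intro hRa
  obtain ⟨R', hR'⟩ := dvd_iff_isRoot.2 hRa
  have h0 : R' ≠ 0 := by
    rintro rfl
    exact hR (by rw [hR', mul_zero])
  have h1 : circ R' * inn R' ≠ 0 := mul_ne_zero (circ_ne_zero R') (inn_ne_zero R')
  obtain ⟨G, hG, hcon⟩ := exists_not_mem_range_X_sub_C ha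
  apply hcon
  obtain ⟨g, hg, rfl⟩ := exists_cmul_pc_eq_of_one_lt (ex_ne_zero h0)
    (fun b => norm_of_isRoot_ex h0) hG
  obtain ⟨w, hw⟩ := exists_cmul_pc_eq (fun b hb => (norm_of_isRoot_inn (Q := S) hb).ne)
    (cmul (pc R') g)
  -- A closed range is its own double complement, and the condition on `f` in the complement is
  -- unchanged when `R` is replaced by `R'`, because both have the same inner factor.
  have hv : P w ∈ pran (toeplitz (ratFun R S)) := by
    rw [← h.submodule_topologicalClosure_eq, ← Submodule.orthogonal_orthogonal_eq_closure,
      Submodule.mem_orthogonal']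
    intro f hf
    obtain ⟨x, hx⟩ := (mem_orthogonal_pran_iff hR hS hRS).1 hf
    rw [hR', inn_mul_of_norm_eq_one h0 ha] at hx
    rw [inner_P]
    exact (forall_inner_eq_zero_iff_exists h0).2 ⟨x, hx⟩ g hg w hw
  obtain ⟨k, hk, w', hw', hP⟩ := (mem_pran_toeplitz_iff hS hRS).1 hv
  have hww : w - w' ∈ High 0 := by
    have h1 := P_eq_iff.1 hP
    have h2 := P_eq_iff.1 (rfl : P w = P w)
    have := (High 0).sub_mem h2 h1
    rwa [sub_sub_sub_cancel_right] at this
  -- `S_in (w - w') = R' (g - (z - a) k)` has spectrum below `deg S_in`; dividing leaves `G - (z -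
  -- a) R'_ex k`, which is thus a polynomial `t`.
  have hdiff : cmul (pc (ex R')) g - cmul (pc (X - C a)) (cmul (pc (ex R')) k)
      ∈ High (((inn S).natDegree : ℤ) - ((circ R' * inn R').natDegree : ℤ)) := by
    refine mem_High_of_cmul h1 (fun b => norm_of_isRoot_circ_mul_inn) ?_
    have := cmul_mem_High (inn_ne_zero S) hww
    rw [map_sub, hw, hw', hR', pc_mul, cmul_mul] at this
    have hf : ∀ f, cmul (pc (circ R' * inn R')) (cmul (pc (ex R')) f) = cmul (pc R') f :=
      fun f => by rw [← cmul_mul, ← pc_mul, ← eq_circ_mul_inn_mul_ex]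
    rw [sub_add_cancel, ← zero_add ((inn S).natDegree : ℤ), map_sub,
      cmul_comm (pc (circ R' * inn R')) (pc (X - C a)), hf, hf]
    exact this
  have hk' := cmul_mem_Low (ex_ne_zero h0) hk
  obtain ⟨t, -, ht⟩ := exists_eq_polyL2
    ((Low 0).sub_mem hG (cmul_mem_Low (X_sub_C_ne_zero a) hk')) hdiff
  -- Division of `t` by `X - a` leaves the constant remainder `t(a)`, so `G` lies in `ℂ + (z - a)
  -- H2`.
  refine ⟨t.eval a, polyL2 0 (t /ₘ (X - C a)) + cmul (pc (ex R')) k,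
    (Low 0).add_mem (polyL2_mem_Low 0 _) hk', ?_⟩
  rw [sub_eq_iff_eq_add] at ht
  rw [ht, map_add, ← add_assoc, add_left_inj]
  conv_lhs => rw [← modByMonic_add_div t (X - C a), modByMonic_X_sub_C_eq_C_eval]
  rw [polyL2, polyL2, ← cmul_pc_C, ← cmul_mul, ← pc_mul, ← cmul_add]
  simp only [pc, map_add]

end ToeplitzRational
end

open ToeplitzRational in
theorem mainTheorem1 (R S : Polynomial ℂ) (hR : R ≠ 0) (hS : S ≠ 0)
    (hRS : ∀ a : ℂ, ¬ (R.IsRoot a ∧ S.IsRoot a)) :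
    -- densely defined and closed
    Dense ((toeplitz (ratFun R S)).domain : Set H2) ∧
    (toeplitz (ratFun R S)).IsClosed ∧
    -- (a) domain and range
    (Subtype.val '' ((toeplitz (ratFun R S)).domain : Set H2) : Set L2)
      = mulH2 (fun x => (circ S).eval (zc x)) ∧
    (pran (toeplitz (ratFun R S)) : Set H2) = P '' mulH2 (ratFun R (inn S * ex S)) ∧
    -- (b) kernel
    (Subtype.val '' (pker (toeplitz (ratFun R S)) : Set H2) : Set L2)
      = polyMul (ratFun (circ S * ex S) (ex R))
          (((inn S).natDegree : ℤ) - ((circ R * inn R).natDegree : ℤ)) ∧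
    -- (c) orthogonal complement of the range, within the Hardy space
    (Subtype.val '' ((pran (toeplitz (ratFun R S)))ᗮ : Set H2) : Set L2)
      = polyMul (ratFun (ex (breve S)) (ex (breve R)))
          (((inn R).natDegree : ℤ) - ((inn S).natDegree : ℤ)) ∧
    -- (d) the Fredholm property
    List.TFAE
      [ IsFredholm (toeplitz (ratFun R S)),
        IsClosed (pran (toeplitz (ratFun R S)) : Set H2),
        ∀ a : ℂ, ‖a‖ = 1 → R.eval a ≠ 0,
        ∀ a : ℂ, ‖a‖ = 1 → S.eval a ≠ 0 → R.eval a / S.eval a ≠ 0 ] := by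
  have hco : IsCoprime R S :=
    (isCoprime_iff_aeval_ne_zero_of_isAlgClosed ℂ ℂ R S).2 fun a => by
      simpa only [coe_aeval_eq_eval, not_and_or, IsRoot.def] using hRS a
  refine ⟨dense_domain hS hco, isClosed_toeplitz R hS, image_domain_eq hS hco, pran_eq hS hco,
    image_pker_eq hR hS hco, image_orthogonal_pran_eq hR hS hco, ?_⟩
  tfae_have 1 → 2 := fun h => h.closed_ran
  tfae_have 2 → 3 := fun h a ha => eval_ne_zero_of_isClosed_pran hR hS hco h ha
  tfae_have 3 → 1 := fun h =>
    have h' := isClosed_pran_and_finiteDimensional hR hS hco h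
    ⟨dense_domain hS hco, isClosed_toeplitz R hS, finiteDimensional_pker hR hS hco, h'.2, h'.1⟩
  tfae_have 3 → 4 := fun h a ha hSa => div_ne_zero (h a ha) hSa
  tfae_have 4 → 3 := fun h a ha hRa =>
    h a ha (fun hSa => hRS a ⟨hRa, hSa⟩) (by rw [hRa, zero_div])
  tfae_finish
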